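/- Let $n$ be a natural number and let $w$ be a permutation of $[n]=\{1,\dots,n\}$. For $p\in\mathfrak S_k$, an occurrence of the pattern $p$ in $w$ is a sequence of positions $1\le i_1<\cdots<i_k\le n$ such that $w(i_1),\dots,w(i_k)$ are in the same relative order as $p(1),\dots,p(k)$; let $[321;3412](w)$ denote the number of occurrences of the pattern $321$ in $w$ plus the number of occurrences of the pattern $3412$ in $w$. For $v\le w$ in the Bruhat order on $\mathfrak S_n$ (that is, some reduced decomposition of $v$ into simple transpositions $(i,i+1)$ is a, not necessarily consecutive, subword of some reduced decomposition of $w$), the Bruhat interval polytope $Q_{v,w}\subset\mathbb R^n$ is the convex hull of the points $(u(1),\dots,u(n))$ for all $u\in\mathfrak S_n$ with $v\le u\le w$. Let $e$ be the identity permutation. If $[321;3412](w)=1$, then the Bruhat interval polytopes $Q_{e,w}$ and $Q_{e,w^{-1}}$ are combinatorially equivalent, that is, their face lattices (the sets of all their faces, ordered by inclusion) are isomorphic. -/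

import Mathlib

/-! Permutations of `[n]` are `Equiv.Perm (Fin n)`; positions and values are shifted by one. -/

/-- The pattern `321`. -/
def pattern321 : Equiv.Perm (Fin 3) :=
  ⟨![2, 1, 0], ![2, 1, 0], by decide, by decide⟩

/-- The pattern `3412`. -/
def pattern3412 : Equiv.Perm (Fin 4) :=
  ⟨![2, 3, 0, 1], ![2, 3, 0, 1], by decide, by decide⟩

/-- The positions `f 0 < ⋯ < f (k - 1)` form an occurrence of the pattern `p` in `w`:
the entries of `w` there are in the same relative order as `p 0, …, p (k - 1)`. -/
def IsPatternOccurrence {k n : ℕ} (p : Equiv.Perm (Fin k)) (w : Equiv.Perm (Fin n))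
    (f : Fin k ↪o Fin n) : Prop :=
  ∀ a b : Fin k, w (f a) < w (f b) ↔ p a < p b

/-- The number of occurrences of the pattern `p` in `w`. -/
noncomputable def patternCount {k n : ℕ} (p : Equiv.Perm (Fin k)) (w : Equiv.Perm (Fin n)) : ℕ :=
  Nat.card {f : Fin k ↪o Fin n // IsPatternOccurrence p w f}

/-- `[321;3412](w)`: the total number of occurrences of `321` and `3412` in `w`. -/
noncomputable def count321And3412 {n : ℕ} (w : Equiv.Perm (Fin n)) : ℕ :=
  patternCount pattern321 w + patternCount pattern3412 w

/-- The simple transposition exchanging the neighbours `i` and `i + 1`. -/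
def simpleTransposition {n : ℕ} (i : Fin (n - 1)) : Equiv.Perm (Fin n) :=
  Equiv.swap ⟨i.val, by omega⟩ ⟨i.val + 1, by omega⟩

/-- The product of simple transpositions spelled by a word. -/
def wordProd {n : ℕ} (ω : List (Fin (n - 1))) : Equiv.Perm (Fin n) :=
  (ω.map simpleTransposition).prod

/-- `ω` is a reduced decomposition of `w`: a word for `w` of minimal length. -/
def IsReducedDecomposition {n : ℕ} (w : Equiv.Perm (Fin n)) (ω : List (Fin (n - 1))) : Prop :=
  wordProd ω = w ∧ ∀ ω' : List (Fin (n - 1)), wordProd ω' = w → ω.length ≤ ω'.length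

/-- The Bruhat order `v ≤ w`: some reduced decomposition of `v` is a (not necessarily
consecutive) subword of some reduced decomposition of `w`. -/
def BruhatLE {n : ℕ} (v w : Equiv.Perm (Fin n)) : Prop :=
  ∃ α β : List (Fin (n - 1)),
    IsReducedDecomposition v α ∧ IsReducedDecomposition w β ∧ α.Sublist β

/-- The point `(u(1), …, u(n))` of `ℝⁿ`. -/
def permPoint {n : ℕ} (u : Equiv.Perm (Fin n)) : Fin n → ℝ :=
  fun i => ((u i).val : ℝ) + 1

/-- The Bruhat interval polytope `Q_{v,w}`. -/
def bruhatIntervalPolytope {n : ℕ} (v w : Equiv.Perm (Fin n)) : Set (Fin n → ℝ) :=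
  convexHull ℝ {x | ∃ u : Equiv.Perm (Fin n), BruhatLE v u ∧ BruhatLE u w ∧ x = permPoint u}

/-- The faces of a convex polytope `P`, ordered by inclusion: the empty face and the subsets on
which some linear functional attains its maximum over `P` (including `P` itself). -/
abbrev PolytopeFace {m : ℕ} (P : Set (Fin m → ℝ)) : Type :=
  {F : Set (Fin m → ℝ) // IsExposed ℝ P F}

/-- Two polytopes are combinatorially equivalent if their face lattices are isomorphic. -/
def CombinatoriallyEquivalent {m k : ℕ} (P : Set (Fin m → ℝ)) (Q : Set (Fin k → ℝ)) : Prop :=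
  Nonempty (PolytopeFace P ≃o PolytopeFace Q)

/-! Faces of a polytope correspond to the vertex sets on which linear functionals are maximal. It
therefore suffices to parametrize the intervals `[1, w]` and `[1, w⁻¹]` by one index set so that
both have the same family of maximizer sets (`HasEqualFamilies`). This is proved by induction on the
number of inversions.

Suppose a descent `p` of `w` is used by no occurrence of `321` or `3412`. Then `v = w * s`, with `s`
the simple transposition at `p`, preserves the initial segment ending at `p`, and so does everything
below `v` (`splitsAt_mul_of_notUsed`, `SplitsAt.of_bruhatLE`). The number of occurrences does not
change. By the lifting property, `[1, w]` consists of `[1, v]` and `[1, v] * s`, while `[1, w⁻¹]`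
consists of `[1, v⁻¹]` and `s * [1, v⁻¹]`. Each doubling gives the face family of a prism over the
smaller one (`maximizerFamily_rightDouble`, `maximizerFamily_leftDouble`), so equality for `v` gives
equality for `w`.

The left doubling is the delicate one, because `s` then acts on entries and not on coordinates. It
uses that the maximizers of a functional on `[1, w]` stay the same when the entries `0, 1, 2, …` are
replaced by any strictly increasing sequence (`maximizers_weightedSum_eq`): one element of the
interval maximizes all threshold sums at once.

The claim is symmetric in `w` and `w⁻¹`, so the reduction stops only when every descent of both is
used by an occurrence. There is only one occurrence, and it then contains all descents. This makes
`w` a reversal of three consecutive points, or the pattern `3412` on four consecutive points, and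
the identity elsewhere. Such a `w` is an involution, and nothing remains to prove
(`inv_eq_self_of_allDescentsUsed`). -/

/-! ### The Bruhat order through rank functions, and the lifting property. -/

section BruhatOrder

variable {n : ℕ}

/-- The smaller of the two points moved by `simpleTransposition p`. -/
def lowerPt (p : Fin (n - 1)) : Fin n := ⟨p.val, by omega⟩

/-- The larger of the two points moved by `simpleTransposition p`. -/
def upperPt (p : Fin (n - 1)) : Fin n := ⟨p.val + 1, by omega⟩

@[simp] lemma val_lowerPt (p : Fin (n - 1)) : (lowerPt p).val = p.val := rfl

@[simp] lemma val_upperPt (p : Fin (n - 1)) : (upperPt p).val = p.val + 1 := rfl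

lemma lowerPt_lt_upperPt (p : Fin (n - 1)) : lowerPt p < upperPt p := by
  simp [Fin.lt_def]

lemma simpleTransposition_eq_swap (p : Fin (n - 1)) :
    simpleTransposition p = Equiv.swap (lowerPt p) (upperPt p) := rfl

@[simp] lemma simpleTransposition_lowerPt (p : Fin (n - 1)) :
    simpleTransposition p (lowerPt p) = upperPt p := by
  simp [simpleTransposition_eq_swap]

@[simp] lemma simpleTransposition_upperPt (p : Fin (n - 1)) :
    simpleTransposition p (upperPt p) = lowerPt p := by
  simp [simpleTransposition_eq_swap]

@[simp] lemma simpleTransposition_mul_self (p : Fin (n - 1)) :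
    simpleTransposition p * simpleTransposition p = 1 := Equiv.swap_mul_self _ _

@[simp] lemma simpleTransposition_inv (p : Fin (n - 1)) :
    (simpleTransposition p)⁻¹ = simpleTransposition p := Equiv.swap_inv _ _

@[simp] lemma mul_simpleTransposition_cancel (w : Equiv.Perm (Fin n)) (p : Fin (n - 1)) :
    w * simpleTransposition p * simpleTransposition p = w := by
  rw [mul_assoc, simpleTransposition_mul_self, mul_one]

@[simp] lemma simpleTransposition_apply_apply (p : Fin (n - 1)) (a : Fin n) :
    simpleTransposition p (simpleTransposition p a) = a := by
  rw [← Equiv.Perm.mul_apply, simpleTransposition_mul_self, Equiv.Perm.one_apply]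

lemma val_simpleTransposition_apply (p : Fin (n - 1)) (a : Fin n) :
    (simpleTransposition p a).val =
      if a.val = p.val then p.val + 1 else if a.val = p.val + 1 then p.val else a.val := by
  rw [simpleTransposition_eq_swap, Equiv.swap_apply_def]
  simp only [Fin.ext_iff, val_lowerPt, val_upperPt]
  split_ifs <;> rfl

lemma simpleTransposition_lt_iff (p : Fin (n - 1)) (a b : Fin n)
    (h : ¬ (a = lowerPt p ∧ b = upperPt p)) (h' : ¬ (a = upperPt p ∧ b = lowerPt p)) :
    simpleTransposition p a < simpleTransposition p b ↔ a < b := by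
  simp only [Fin.ext_iff, Fin.lt_def, val_lowerPt, val_upperPt,
    val_simpleTransposition_apply] at *
  split_ifs <;> omega

/-- The number of positions before `i` whose entry is at least `j`. -/
def rankCount (w : Equiv.Perm (Fin n)) (i j : ℕ) : ℕ :=
  (Finset.univ.filter fun a : Fin n => a.val < i ∧ j ≤ (w a).val).card

lemma rankCount_succ (w : Equiv.Perm (Fin n)) (a : Fin n) (j : ℕ) :
    rankCount w (a.val + 1) j = rankCount w a.val j + if j ≤ (w a).val then 1 else 0 := by
  unfold rankCount
  split_ifs with h
  · rw [← Finset.card_insert_of_notMem (a := a) (by simp)]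
    congr 1
    ext b
    simp only [Finset.mem_filter, Finset.mem_univ, true_and, Finset.mem_insert, Fin.ext_iff]
    constructor
    · rintro ⟨h1, h2⟩
      by_cases hb : b.val = a.val
      · exact Or.inl hb
      · exact Or.inr ⟨by omega, h2⟩
    · rintro (h1 | ⟨h1, h2⟩)
      · have : b = a := Fin.ext h1
        subst this
        exact ⟨by omega, h⟩
      · exact ⟨by omega, h2⟩
  · rw [add_zero]
    congr 1
    ext b
    simp only [Finset.mem_filter, Finset.mem_univ, true_and]
    constructor
    · rintro ⟨h1, h2⟩
      refine ⟨?_, h2⟩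
      rcases Nat.lt_succ_iff_lt_or_eq.mp h1 with h3 | h3
      · exact h3
      · have : b = a := Fin.ext h3
        subst this
        exact absurd h2 h
    · rintro ⟨h1, h2⟩
      exact ⟨by omega, h2⟩

lemma rankCount_mul_of_ne (w : Equiv.Perm (Fin n)) (p : Fin (n - 1)) {i : ℕ}
    (hi : i ≠ p.val + 1) (j : ℕ) :
    rankCount (w * simpleTransposition p) i j = rankCount w i j := by
  unfold rankCount
  refine Finset.card_equiv (simpleTransposition p) fun a => ?_
  simp only [Finset.mem_filter, Finset.mem_univ, true_and]
  rw [Equiv.Perm.mul_apply, val_simpleTransposition_apply]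
  refine and_congr_left fun _ => ?_
  split_ifs <;> omega

lemma rankCount_at (w : Equiv.Perm (Fin n)) (p : Fin (n - 1)) (j : ℕ) :
    rankCount w (p.val + 1) j =
      rankCount w p.val j + if j ≤ (w (lowerPt p)).val then 1 else 0 :=
  rankCount_succ w (lowerPt p) j

lemma rankCount_after (w : Equiv.Perm (Fin n)) (p : Fin (n - 1)) (j : ℕ) :
    rankCount w (p.val + 1 + 1) j =
      rankCount w (p.val + 1) j + if j ≤ (w (upperPt p)).val then 1 else 0 :=
  rankCount_succ w (upperPt p) j

lemma rankCount_mul_at (w : Equiv.Perm (Fin n)) (p : Fin (n - 1)) (j : ℕ) :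
    rankCount (w * simpleTransposition p) (p.val + 1) j =
      rankCount w p.val j + if j ≤ (w (upperPt p)).val then 1 else 0 := by
  rw [rankCount_at, rankCount_mul_of_ne _ _ (by omega)]
  simp

/-- The comparison of permutations by their rank functions. -/
def RankLE (u w : Equiv.Perm (Fin n)) : Prop := ∀ i j, rankCount u i j ≤ rankCount w i j

/-- Right multiplication changes only row `p + 1` of the rank function. In that row the new rank of
`w` is at least the old one, which gives the first claim. The second follows from the inequalities
in the two neighbouring rows `p` and `p + 2`, which do not change. -/
lemma RankLE.mul_right_of_ascent {u w : Equiv.Perm (Fin n)} (h : RankLE u w) (p : Fin (n - 1))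
    (hw : w (lowerPt p) < w (upperPt p)) :
    RankLE u (w * simpleTransposition p) ∧
      RankLE (u * simpleTransposition p) (w * simpleTransposition p) := by
  refine ⟨fun i j => ?_, fun i j => ?_⟩ <;> by_cases hi : i = p.val + 1
  · subst hi
    refine (h _ _).trans ?_
    rw [rankCount_mul_at, rankCount_at]
    rw [Fin.lt_def] at hw
    split_ifs <;> omega
  · rw [rankCount_mul_of_ne _ _ hi]
    exact h i j
  · subst hi
    rw [rankCount_mul_at, rankCount_mul_at]
    have h1 := h p.val j
    have h2 := h (p.val + 1 + 1) j
    rw [rankCount_after, rankCount_after, rankCount_at, rankCount_at] at h2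
    rw [Fin.lt_def] at hw
    split_ifs at * <;> omega
  · rw [rankCount_mul_of_ne _ _ hi, rankCount_mul_of_ne _ _ hi]
    exact h i j

/-- This lemma and `RankLE.mul_mul_of_descent` are the lifting property. Nothing is assumed about
`w` at `p`; the rows `p` and `p + 2` again force the inequality in row `p + 1`. -/
lemma RankLE.mul_of_ascent {u w : Equiv.Perm (Fin n)} (h : RankLE u w) (p : Fin (n - 1))
    (hu : u (lowerPt p) < u (upperPt p)) :
    RankLE u (w * simpleTransposition p) := by
  intro i j
  by_cases hi : i = p.val + 1
  · subst hi
    rw [rankCount_mul_at, rankCount_at]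
    have h1 := h p.val j
    have h2 := h (p.val + 1 + 1) j
    rw [rankCount_after, rankCount_after, rankCount_at, rankCount_at] at h2
    rw [Fin.lt_def] at hu
    split_ifs at * <;> omega
  · rw [rankCount_mul_of_ne _ _ hi]
    exact h i j

lemma RankLE.mul_mul_of_descent {u w : Equiv.Perm (Fin n)} (h : RankLE u w)
    (p : Fin (n - 1)) (hu : u (upperPt p) < u (lowerPt p)) :
    RankLE (u * simpleTransposition p) (w * simpleTransposition p) := by
  intro i j
  by_cases hi : i = p.val + 1
  · subst hi
    rw [rankCount_mul_at, rankCount_mul_at]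
    have h1 := h p.val j
    have h2 := h (p.val + 1 + 1) j
    rw [rankCount_after, rankCount_after, rankCount_at, rankCount_at] at h2
    rw [Fin.lt_def] at hu
    split_ifs at * <;> omega
  · rw [rankCount_mul_of_ne _ _ hi, rankCount_mul_of_ne _ _ hi]
    exact h i j

/-- `u` maps the initial segment ending at `lowerPt p` to itself. -/
def SplitsAt (p : Fin (n - 1)) (u : Equiv.Perm (Fin n)) : Prop :=
  ∀ a : Fin n, (u a).val ≤ p.val ↔ a.val ≤ p.val

lemma splitsAt_of_forall_le {p : Fin (n - 1)} {u : Equiv.Perm (Fin n)}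
    (h : ∀ a : Fin n, a.val ≤ p.val → (u a).val ≤ p.val) : SplitsAt p u := by
  refine fun a => ⟨fun ha => ?_, h a⟩
  have := Equiv.Perm.perm_symm_on_of_perm_on_finite (f := u) (p := fun a => a.val ≤ p.val)
    h ha
  simpa using this

/-- Expressed as the vanishing of a single rank, the condition visibly passes to smaller elements of
the order. -/
lemma splitsAt_iff_rankCount {p : Fin (n - 1)} {u : Equiv.Perm (Fin n)} :
    SplitsAt p u ↔ rankCount u (p.val + 1) (p.val + 1) = 0 := by
  rw [rankCount, Finset.card_eq_zero, Finset.filter_eq_empty_iff]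
  constructor
  · rintro h a - ⟨h1, h2⟩
    have := (h a).2 (by omega)
    omega
  · intro h
    refine splitsAt_of_forall_le fun a ha => ?_
    have := h (Finset.mem_univ a)
    omega

lemma SplitsAt.of_rankLE {p : Fin (n - 1)} {u w : Equiv.Perm (Fin n)} (hw : SplitsAt p w)
    (h : RankLE u w) : SplitsAt p u := by
  rw [splitsAt_iff_rankCount] at *
  exact Nat.le_zero.mp (hw ▸ h _ _)

lemma SplitsAt.lt {p : Fin (n - 1)} {u : Equiv.Perm (Fin n)} (h : SplitsAt p u) {a b : Fin n}
    (ha : a.val ≤ p.val) (hb : p.val < b.val) : u a < u b := by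
  have h1 := (h a).2 ha
  have h2 := (h b).not.2 (by omega)
  rw [Fin.lt_def]
  omega

lemma SplitsAt.ascent {p : Fin (n - 1)} {u : Equiv.Perm (Fin n)} (h : SplitsAt p u) :
    u (lowerPt p) < u (upperPt p) := h.lt (by simp) (by simp)

lemma SplitsAt.inv {p : Fin (n - 1)} {u : Equiv.Perm (Fin n)} (h : SplitsAt p u) :
    SplitsAt p u⁻¹ := fun a => by
  have := h (u⁻¹ a)
  simpa using this.symm

lemma eq_one_of_forall_splitsAt {u : Equiv.Perm (Fin n)} (h : ∀ p : Fin (n - 1), SplitsAt p u) :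
    u = 1 := by
  ext a
  rw [Equiv.Perm.one_apply]
  have h1 : a.val < n - 1 → (u a).val ≤ a.val := fun ha => (h ⟨a.val, ha⟩ a).2 le_rfl
  have h2 : 0 < a.val → a.val ≤ (u a).val := fun ha => by
    have := (h ⟨a.val - 1, by omega⟩ a).not.2 (by simp only; omega)
    simp only at this
    omega
  omega

lemma eq_one_of_forall_ascent {w : Equiv.Perm (Fin n)}
    (h : ∀ p : Fin (n - 1), w (lowerPt p) < w (upperPt p)) : w = 1 := by
  have hw : StrictMono w := by
    cases n with
    | zero => intro a; exact a.elim0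
    | succ m => exact Fin.strictMono_iff_lt_succ.2 fun i => h i
  ext a
  have h1 := Subsingleton.elim (hw.orderIsoOfSurjective w w.surjective) (OrderIso.refl _)
  have := congrArg (fun e : Fin n ≃o Fin n => (e a).val) h1
  simpa using this

/-- The number of inversions. -/
def inversionCount (w : Equiv.Perm (Fin n)) : ℕ :=
  (Finset.univ.filter fun x : Fin n × Fin n => x.1 < x.2 ∧ w x.2 < w x.1).card

/-- Applying the transposition to both positions carries the inversions of `w` bijectively to those
of the product, except for the new inversion at `p` itself. -/
lemma inversionCount_mul_of_ascent (w : Equiv.Perm (Fin n)) (p : Fin (n - 1))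
    (hw : w (lowerPt p) < w (upperPt p)) :
    inversionCount (w * simpleTransposition p) = inversionCount w + 1 := by
  unfold inversionCount
  have key : (Finset.univ.filter fun x : Fin n × Fin n =>
      x.1 < x.2 ∧ (w * simpleTransposition p) x.2 < (w * simpleTransposition p) x.1) =
      insert (lowerPt p, upperPt p) ((Finset.univ.filter fun x : Fin n × Fin n =>
        x.1 < x.2 ∧ w x.2 < w x.1).map
        ((simpleTransposition p).prodCongr (simpleTransposition p)).toEmbedding) := by
    ext ⟨a, b⟩
    simp only [Finset.mem_filter, Finset.mem_univ, true_and, Finset.mem_insert, Finset.mem_map,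
      Prod.exists, Equiv.coe_toEmbedding, Equiv.prodCongr_apply,
      Prod.map_apply, Prod.mk.injEq]
    simp only [Equiv.Perm.mul_apply]
    constructor
    · rintro ⟨h1, h2⟩
      by_cases h : a = lowerPt p ∧ b = upperPt p
      · exact Or.inl h
      · refine Or.inr ⟨simpleTransposition p a, simpleTransposition p b, ⟨?_, h2⟩, by simp, by simp⟩
        refine (simpleTransposition_lt_iff p a b h ?_).2 h1
        rintro ⟨rfl, rfl⟩
        exact absurd h1 (lowerPt_lt_upperPt p).not_gt
    · rintro (⟨rfl, rfl⟩ | ⟨a', b', ⟨h1, h2⟩, rfl, rfl⟩)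
      · simpa using ⟨lowerPt_lt_upperPt p, hw⟩
      · simp only [simpleTransposition_apply_apply]
        refine ⟨(simpleTransposition_lt_iff p a' b' ?_ ?_).2 h1, h2⟩
        · rintro ⟨rfl, rfl⟩
          exact absurd h2 hw.not_gt
        · rintro ⟨rfl, rfl⟩
          exact absurd h1 (lowerPt_lt_upperPt p).not_gt
  rw [key, Finset.card_insert_of_notMem, Finset.card_map]
  simp only [Finset.mem_filter, Finset.mem_univ, true_and, Finset.mem_map, Prod.exists,
    Equiv.coe_toEmbedding, Equiv.prodCongr_apply, Prod.map_apply, Prod.mk.injEq, not_exists,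
    not_and, and_imp]
  intro a b h1 h2 ha hb
  have ha' := congrArg (simpleTransposition p) ha
  have hb' := congrArg (simpleTransposition p) hb
  simp only [simpleTransposition_apply_apply, simpleTransposition_lowerPt,
    simpleTransposition_upperPt] at ha' hb'
  subst ha' hb'
  exact absurd h1 (lowerPt_lt_upperPt p).not_gt

lemma inversionCount_mul_of_descent (w : Equiv.Perm (Fin n)) (p : Fin (n - 1))
    (hw : w (upperPt p) < w (lowerPt p)) :
    inversionCount w = inversionCount (w * simpleTransposition p) + 1 := by
  rw [← inversionCount_mul_of_ascent _ p (by simpa using hw), mul_simpleTransposition_cancel]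

lemma ascent_or_descent (w : Equiv.Perm (Fin n)) (p : Fin (n - 1)) :
    w (lowerPt p) < w (upperPt p) ∨ w (upperPt p) < w (lowerPt p) :=
  lt_or_gt_of_ne fun h => (lowerPt_lt_upperPt p).ne (w.injective h)

lemma exists_descent_of_ne_one {w : Equiv.Perm (Fin n)} (hw : w ≠ 1) :
    ∃ p : Fin (n - 1), w (upperPt p) < w (lowerPt p) := by
  by_contra! h
  exact hw (eq_one_of_forall_ascent fun p => (ascent_or_descent w p).resolve_right (h p).not_gt)

/-- Induction removing descents on the right. -/
lemma descent_induction {C : Equiv.Perm (Fin n) → Prop} (one : C 1)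
    (step : ∀ (w : Equiv.Perm (Fin n)) (p : Fin (n - 1)), w (upperPt p) < w (lowerPt p) →
      C (w * simpleTransposition p) → C w) (w : Equiv.Perm (Fin n)) : C w := by
  induction hk : inversionCount w generalizing w with
  | zero =>
    by_cases hw : w = 1
    · exact hw ▸ one
    · obtain ⟨p, hp⟩ := exists_descent_of_ne_one hw
      have := inversionCount_mul_of_descent w p hp
      omega
  | succ k ih =>
    by_cases hw : w = 1
    · exact hw ▸ one
    · obtain ⟨p, hp⟩ := exists_descent_of_ne_one hw
      have := inversionCount_mul_of_descent w p hp
      exact step w p hp (ih _ (by omega))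

@[simp] lemma inversionCount_one : inversionCount (1 : Equiv.Perm (Fin n)) = 0 := by
  rw [inversionCount, Finset.card_eq_zero, Finset.filter_eq_empty_iff]
  rintro ⟨a, b⟩ - ⟨h1, h2⟩
  exact absurd h1 h2.not_gt

lemma wordProd_append_singleton (ω : List (Fin (n - 1))) (p : Fin (n - 1)) :
    wordProd (ω ++ [p]) = wordProd ω * simpleTransposition p := by
  simp [wordProd]

lemma inversionCount_wordProd_le (ω : List (Fin (n - 1))) :
    inversionCount (wordProd ω) ≤ ω.length := by
  induction ω using List.reverseRecOn with
  | nil => simp [wordProd]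
  | append_singleton ω p ih =>
    rw [wordProd_append_singleton, List.length_append, List.length_singleton]
    rcases ascent_or_descent (wordProd ω) p with h | h
    · rw [inversionCount_mul_of_ascent _ _ h]
      omega
    · have := inversionCount_mul_of_descent _ _ h
      omega

lemma exists_wordProd_eq (w : Equiv.Perm (Fin n)) :
    ∃ ω : List (Fin (n - 1)), wordProd ω = w ∧ ω.length = inversionCount w := by
  induction w using descent_induction with
  | one => exact ⟨[], by simp [wordProd]⟩
  | step w p hp ih =>
    obtain ⟨ω, h1, h2⟩ := ih
    refine ⟨ω ++ [p], ?_, ?_⟩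
    · rw [wordProd_append_singleton, h1, mul_simpleTransposition_cancel]
    · rw [List.length_append, h2, inversionCount_mul_of_descent w p hp, List.length_singleton]

lemma isReducedDecomposition_iff {w : Equiv.Perm (Fin n)} {ω : List (Fin (n - 1))} :
    IsReducedDecomposition w ω ↔ wordProd ω = w ∧ ω.length = inversionCount w := by
  refine and_congr_right fun h => ⟨fun hmin => ?_, fun hlen ω' h' => ?_⟩
  · obtain ⟨ω', h1, h2⟩ := exists_wordProd_eq w
    have h3 := hmin ω' h1
    have h4 := inversionCount_wordProd_le ω
    rw [h] at h4
    omega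
  · rw [hlen, ← h']
    exact inversionCount_wordProd_le ω'

/-- In a reduced word each letter is applied at an ascent, so `RankLE.mul_right_of_ascent` preserves
the comparison whether the subword takes the letter or omits it. -/
lemma rankLE_of_sublist {α β : List (Fin (n - 1))}
    (hβ : β.length = inversionCount (wordProd β)) (h : α.Sublist β) :
    RankLE (wordProd α) (wordProd β) := by
  induction β using List.reverseRecOn generalizing α with
  | nil =>
    rw [List.sublist_nil.mp h]
    exact fun _ _ => le_rfl
  | append_singleton β p ih =>
    rw [wordProd_append_singleton, List.length_append, List.length_singleton] at hβ
    have hle := inversionCount_wordProd_le β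
    -- At a descent the longer word would have more letters than its product has inversions.
    have hasc : wordProd β (lowerPt p) < wordProd β (upperPt p) := by
      refine (ascent_or_descent _ p).resolve_right fun hd => ?_
      have := inversionCount_mul_of_descent _ p hd
      omega
    rw [inversionCount_mul_of_ascent _ _ hasc] at hβ
    obtain ⟨α₁, α₂, rfl, h1, h2⟩ := List.sublist_append_iff.mp h
    have ih' := ih (by omega) h1
    have hup := ih'.mul_right_of_ascent p hasc
    rw [wordProd_append_singleton]
    rcases List.sublist_singleton.mp h2 with rfl | rfl
    · rw [List.append_nil]
      exact hup.1
    · rw [wordProd_append_singleton]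
      exact hup.2

lemma rankLE_one_iff {u : Equiv.Perm (Fin n)} : RankLE u 1 ↔ u = 1 := by
  refine ⟨fun h => eq_one_of_forall_splitsAt fun p => SplitsAt.of_rankLE (fun a => ?_) h, ?_⟩
  · simp
  · rintro rfl _ _
    exact le_rfl

/-- A descent `p` of `w` is removed. If `p` is an ascent of `u`, the letter `p` is appended only to
the word for `w`; if it is a descent, it is appended to both words. -/
lemma bruhatLE_of_rankLE {u w : Equiv.Perm (Fin n)} (h : RankLE u w) : BruhatLE u w := by
  induction w using descent_induction generalizing u with
  | one =>
    rw [rankLE_one_iff] at h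
    subst h
    exact ⟨[], [], by simp [isReducedDecomposition_iff, wordProd],
      by simp [isReducedDecomposition_iff, wordProd], List.Sublist.refl _⟩
  | step w p hp ih =>
    rcases ascent_or_descent u p with hu | hu
    · obtain ⟨α, β, hα, hβ, hs⟩ := ih (h.mul_of_ascent p hu)
      rw [isReducedDecomposition_iff] at hβ
      refine ⟨α, β ++ [p], hα, ?_, hs.trans (List.sublist_append_left _ _)⟩
      rw [isReducedDecomposition_iff, wordProd_append_singleton, hβ.1,
        mul_simpleTransposition_cancel, inversionCount_mul_of_descent w p hp]
      simp [hβ.2]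
    · obtain ⟨α, β, hα, hβ, hs⟩ := ih (h.mul_mul_of_descent p hu)
      rw [isReducedDecomposition_iff] at hα hβ
      refine ⟨α ++ [p], β ++ [p], ?_, ?_, hs.append (List.Sublist.refl _)⟩
      · rw [isReducedDecomposition_iff, wordProd_append_singleton, hα.1,
          mul_simpleTransposition_cancel, inversionCount_mul_of_descent u p hu]
        simp [hα.2]
      · rw [isReducedDecomposition_iff, wordProd_append_singleton, hβ.1,
          mul_simpleTransposition_cancel, inversionCount_mul_of_descent w p hp]
        simp [hβ.2]

lemma bruhatLE_iff_rankLE {u w : Equiv.Perm (Fin n)} : BruhatLE u w ↔ RankLE u w := by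
  refine ⟨?_, bruhatLE_of_rankLE⟩
  rintro ⟨α, β, ⟨rfl, -⟩, hβ, hs⟩
  rw [isReducedDecomposition_iff] at hβ
  obtain ⟨rfl, hβ⟩ := hβ
  exact rankLE_of_sublist hβ hs

lemma one_bruhatLE (u : Equiv.Perm (Fin n)) : BruhatLE 1 u := by
  obtain ⟨ω, h⟩ := exists_wordProd_eq u
  exact ⟨[], ω, by simp [isReducedDecomposition_iff, wordProd], isReducedDecomposition_iff.2 h,
    List.nil_sublist _⟩

lemma wordProd_reverse (ω : List (Fin (n - 1))) : wordProd ω.reverse = (wordProd ω)⁻¹ := by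
  induction ω with
  | nil => simp [wordProd]
  | cons p ω ih =>
    rw [List.reverse_cons, wordProd_append_singleton, ih]
    simp [wordProd]

lemma IsReducedDecomposition.reverse {w : Equiv.Perm (Fin n)} {ω : List (Fin (n - 1))}
    (h : IsReducedDecomposition w ω) : IsReducedDecomposition w⁻¹ ω.reverse := by
  refine ⟨by rw [wordProd_reverse, h.1], fun ω' h' => ?_⟩
  have := h.2 ω'.reverse (by rw [wordProd_reverse, h', inv_inv])
  simpa using this

lemma BruhatLE.inv {u w : Equiv.Perm (Fin n)} (h : BruhatLE u w) : BruhatLE u⁻¹ w⁻¹ := by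
  obtain ⟨α, β, hα, hβ, hs⟩ := h
  exact ⟨α.reverse, β.reverse, hα.reverse, hβ.reverse, hs.reverse⟩

/-- This is the source of the doublings: going up by one simple transposition adds to a lower
interval its translate. -/
lemma bruhatLE_mul_iff {u w : Equiv.Perm (Fin n)} {p : Fin (n - 1)}
    (hw : w (lowerPt p) < w (upperPt p)) :
    BruhatLE u (w * simpleTransposition p) ↔
      BruhatLE u w ∨ BruhatLE (u * simpleTransposition p) w := by
  simp only [bruhatLE_iff_rankLE]
  constructor
  · intro h
    rcases ascent_or_descent u p with hu | hu
    · left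
      simpa using h.mul_of_ascent p hu
    · right
      simpa using h.mul_mul_of_descent p hu
  · rintro (h | h)
    · exact (h.mul_right_of_ascent p hw).1
    · simpa using (h.mul_right_of_ascent p hw).2

lemma SplitsAt.of_bruhatLE {p : Fin (n - 1)} {u w : Equiv.Perm (Fin n)} (hw : SplitsAt p w)
    (h : BruhatLE u w) : SplitsAt p u := hw.of_rankLE (bruhatLE_iff_rankLE.1 h)

end BruhatOrder

/-! ### Maximizers of functionals on lower intervals, and prisms. -/

section MaximizerFamilies

variable {n : ℕ}

/-- The value of the functional `c` at the point `(b (u 0), …, b (u (n - 1)))`. -/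
def weightedSum (b : ℕ → ℝ) (c : Fin n → ℝ) (u : Equiv.Perm (Fin n)) : ℝ :=
  ∑ i, c i * b (u i).val

lemma weightedSum_mul (b : ℕ → ℝ) (c : Fin n → ℝ) (u s : Equiv.Perm (Fin n)) :
    weightedSum b c (u * s) = weightedSum b (c ∘ s.symm) u := by
  unfold weightedSum
  conv_lhs => rw [← Equiv.sum_comp s.symm]
  simp

lemma weightedSum_mul_simpleTransposition (b : ℕ → ℝ) (c : Fin n → ℝ)
    (u : Equiv.Perm (Fin n)) (p : Fin (n - 1)) :
    weightedSum b c (u * simpleTransposition p) = weightedSum b c u +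
      (c (lowerPt p) - c (upperPt p)) * (b (u (upperPt p)).val - b (u (lowerPt p)).val) := by
  rw [← sub_eq_iff_eq_add', weightedSum, weightedSum, ← Finset.sum_sub_distrib,
    Fintype.sum_eq_add (lowerPt p) (upperPt p) (lowerPt_lt_upperPt p).ne]
  · simp only [Equiv.Perm.mul_apply, simpleTransposition_lowerPt, simpleTransposition_upperPt]
    ring
  · rintro i ⟨h1, h2⟩
    rw [Equiv.Perm.mul_apply, simpleTransposition_eq_swap, Equiv.swap_apply_of_ne_of_ne h1 h2,
      sub_self]

/-- The indicator of the numbers that are at least `k`. -/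
noncomputable def upperIndicator (k m : ℕ) : ℝ := if k ≤ m then 1 else 0

lemma upperIndicator_mono (k : ℕ) : Monotone (upperIndicator k) := by
  intro a b hab
  unfold upperIndicator
  split_ifs <;> first | omega | norm_num

/-- A lower Bruhat interval contains an element that maximizes all the sums
`∑_{u i ≥ k} c i` simultaneously. -/
lemma exists_forall_weightedSum_upperIndicator_le (w : Equiv.Perm (Fin n)) (c : Fin n → ℝ) :
    ∃ u₀, BruhatLE u₀ w ∧ ∀ u, BruhatLE u w → ∀ k,
      weightedSum (upperIndicator k) c u ≤ weightedSum (upperIndicator k) c u₀ := by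
  induction w using descent_induction generalizing c with
  | one =>
    refine ⟨1, one_bruhatLE 1, fun u hu k => ?_⟩
    rw [bruhatLE_iff_rankLE, rankLE_one_iff] at hu
    rw [hu]
  | step w p hp ih =>
    have hL : ∀ u, BruhatLE u w ↔ BruhatLE u (w * simpleTransposition p) ∨
        BruhatLE (u * simpleTransposition p) (w * simpleTransposition p) := fun u => by
      rw [← bruhatLE_mul_iff (by simpa using hp), mul_simpleTransposition_cancel]
    -- If the larger coefficient is at the upper point, undoing a descent of `u` at `p` moves the
    -- larger entry there and lowers no threshold sum. So the optimum over the smaller interval is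
    -- also optimal for `w`.
    have main : ∀ c : Fin n → ℝ, c (lowerPt p) ≤ c (upperPt p) →
        ∃ u₀, BruhatLE u₀ w ∧ ∀ u, BruhatLE u w → ∀ k,
          weightedSum (upperIndicator k) c u ≤ weightedSum (upperIndicator k) c u₀ := by
      intro c hc
      obtain ⟨u₀, h0, hmax⟩ := ih c
      refine ⟨u₀, (hL _).2 (Or.inl h0), fun u hu k => ?_⟩
      rw [bruhatLE_iff_rankLE] at hu
      rcases ascent_or_descent u p with hu' | hu'
      · exact hmax u (bruhatLE_of_rankLE (hu.mul_of_ascent p hu')) k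
      · refine le_trans ?_ (hmax _ (bruhatLE_of_rankLE (hu.mul_mul_of_descent p hu')) k)
        rw [weightedSum_mul_simpleTransposition]
        have := upperIndicator_mono k (Fin.lt_def.1 hu').le
        nlinarith
    rcases le_total (c (lowerPt p)) (c (upperPt p)) with hc | hc
    · exact main c hc
    -- Since `p` is a descent of `w`, the interval below `w` is stable under right multiplication.
    -- This reduces to the case above with the two coefficients exchanged.
    · obtain ⟨u₀, h0, hmax⟩ := main (c ∘ simpleTransposition p) (by simpa using hc)
      have hL' : ∀ u, BruhatLE u w → BruhatLE (u * simpleTransposition p) w := fun u hu => by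
        rw [hL, mul_simpleTransposition_cancel]
        exact ((hL u).1 hu).symm
      have hsymm : (simpleTransposition p).symm = simpleTransposition p :=
        simpleTransposition_inv p
      refine ⟨u₀ * simpleTransposition p, hL' _ h0, fun u hu k => ?_⟩
      have := hmax _ (hL' u hu) k
      have e : (c ∘ simpleTransposition p) ∘ simpleTransposition p = c := by
        ext i
        simp
      rw [weightedSum_mul, hsymm, e] at this
      rwa [weightedSum_mul, hsymm]

/-- The indices at which a function attains its maximum. -/
def maximizers {ι : Type*} (f : ι → ℝ) : Set ι := {i | ∀ j, f j ≤ f i}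

lemma maximizers_add_const {ι : Type*} (f : ι → ℝ) (t : ℝ) :
    maximizers (fun i => f i + t) = maximizers f := by
  simp [maximizers]

lemma maximizers_nonempty {ι : Type*} [Finite ι] [Nonempty ι] (f : ι → ℝ) :
    (maximizers f).Nonempty := Finite.exists_max f

/-- Abel summation: the increments of `b` become the coefficients of threshold indicators, and they
are positive when `b` is strictly increasing. -/
lemma eq_sum_upperIndicator (b : ℕ → ℝ) {m N : ℕ} (hm : m ≤ N) :
    b m = b 0 + ∑ k ∈ Finset.range N, (b (k + 1) - b k) * upperIndicator (k + 1) m := by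
  induction N, hm using Nat.le_induction with
  | base =>
    rw [Finset.sum_congr rfl (g := fun k => b (k + 1) - b k), Finset.sum_range_sub]
    · ring
    · intro k hk
      rw [upperIndicator, if_pos (by simpa using hk), mul_one]
  | succ N hN ih =>
    rw [Finset.sum_range_succ, ← add_assoc, ← ih, upperIndicator, if_neg (by omega)]
    ring

lemma weightedSum_eq (b : ℕ → ℝ) (c : Fin n → ℝ) (u : Equiv.Perm (Fin n)) :
    weightedSum b c u = b 0 * ∑ i, c i + ∑ k ∈ Finset.range n,
      (b (k + 1) - b k) * weightedSum (upperIndicator (k + 1)) c u := by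
  simp only [weightedSum, Finset.mul_sum]
  rw [Finset.sum_comm, ← Finset.sum_add_distrib]
  refine Finset.sum_congr rfl fun i _ => ?_
  rw [eq_sum_upperIndicator b (u i).isLt.le, mul_add, Finset.mul_sum, mul_comm (c i)]
  congr 1
  exact Finset.sum_congr rfl fun k _ => by ring

/-- On a lower Bruhat interval, the maximizers of a functional do not depend on the strictly
increasing sequence of entries. -/
lemma maximizers_weightedSum_eq {ι : Type*} {g : ι → Equiv.Perm (Fin n)}
    {w : Equiv.Perm (Fin n)} (hg : Set.range g = {u | BruhatLE u w}) (c : Fin n → ℝ)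
    {b b' : ℕ → ℝ} (hb : StrictMono b) (hb' : StrictMono b') :
    maximizers (fun i => weightedSum b c (g i)) = maximizers (fun i => weightedSum b' c (g i)) := by
  obtain ⟨u₀, h0, hmax⟩ := exists_forall_weightedSum_upperIndicator_le w c
  have hmem : ∀ i, BruhatLE (g i) w := fun i => (Set.ext_iff.1 hg _).1 ⟨i, rfl⟩
  obtain ⟨i₀, rfl⟩ := (Set.ext_iff.1 hg u₀).2 h0
  -- Up to a constant the functional is a positive combination of threshold sums, all of them
  -- maximal at `g i₀`. Attaining the maximum thus means agreeing with `g i₀` in every threshold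
  -- sum, a condition without `b`.
  have key : ∀ {b : ℕ → ℝ}, StrictMono b → maximizers (fun i => weightedSum b c (g i)) =
      {i | ∀ k ∈ Finset.range n, weightedSum (upperIndicator (k + 1)) c (g i) =
        weightedSum (upperIndicator (k + 1)) c (g i₀)} := by
    intro b hb
    have hpos : ∀ k, 0 < b (k + 1) - b k := fun k => sub_pos.2 (hb k.lt_succ_self)
    have hle : ∀ i, ∀ k ∈ Finset.range n,
        (b (k + 1) - b k) * weightedSum (upperIndicator (k + 1)) c (g i) ≤
        (b (k + 1) - b k) * weightedSum (upperIndicator (k + 1)) c (g i₀) := fun i k _ =>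
      mul_le_mul_of_nonneg_left (hmax _ (hmem i) _) (hpos k).le
    ext i
    constructor
    · intro hi k hk
      have h1 := hi i₀
      simp only [weightedSum_eq b] at h1
      have h2 := (Finset.sum_eq_sum_iff_of_le (hle i)).1
        (le_antisymm (Finset.sum_le_sum (hle i)) (by linarith)) k hk
      exact mul_left_cancel₀ (hpos k).ne' h2
    · intro hi j
      simp only [weightedSum_eq b]
      have := Finset.sum_le_sum (hle j)
      have e : ∑ k ∈ Finset.range n, (b (k + 1) - b k) * weightedSum (upperIndicator (k + 1)) c (g i)
          = ∑ k ∈ Finset.range n,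
            (b (k + 1) - b k) * weightedSum (upperIndicator (k + 1)) c (g i₀) :=
        Finset.sum_congr rfl fun k hk => by rw [hi k hk]
      linarith
  rw [key hb, key hb']

/-- The family of the sets of maximizers of linear functionals on the points `g i`. -/
def maximizerFamily {ι : Type*} (g : ι → Equiv.Perm (Fin n)) : Set (Set ι) :=
  {A | ∃ c : Fin n → ℝ, A = maximizers fun i => weightedSum (fun m => (m : ℝ)) c (g i)}

/-- The family of faces of a prism over a family of faces. -/
def prismFamily {ι : Type*} (F : Set (Set ι)) : Set (Set (ι × Bool)) :=
  {B | ∃ A ∈ F, B = A ×ˢ {false} ∨ B = A ×ˢ {true} ∨ B = A ×ˢ Set.univ}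

lemma maximizers_bool_false {ι : Type*} {f : ι × Bool → ℝ} {i₀ : ι}
    (h : ∀ i, f (i, true) < f (i₀, false)) :
    maximizers f = maximizers (fun i => f (i, false)) ×ˢ {false} := by
  ext ⟨i, b⟩
  simp only [maximizers, Set.mem_ofPred_eq, Set.mem_prod, Set.mem_singleton_iff, Prod.forall,
    Bool.forall_bool]
  cases b
  · refine ⟨fun hi => ⟨fun j => (hi j).1, rfl⟩, fun hi j => ⟨hi.1 j, ?_⟩⟩
    exact (h j).le.trans (hi.1 i₀)
  · simp only [Bool.true_eq_false, and_false, iff_false]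
    exact fun hi => absurd (hi i₀).1 (h i).not_ge

lemma maximizers_bool_true {ι : Type*} {f : ι × Bool → ℝ} {i₀ : ι}
    (h : ∀ i, f (i, false) < f (i₀, true)) :
    maximizers f = maximizers (fun i => f (i, true)) ×ˢ {true} := by
  ext ⟨i, b⟩
  simp only [maximizers, Set.mem_ofPred_eq, Set.mem_prod, Set.mem_singleton_iff, Prod.forall,
    Bool.forall_bool]
  cases b
  · simp only [Bool.false_eq_true, and_false, iff_false]
    exact fun hi => absurd (hi i₀).2 (h i).not_ge
  · refine ⟨fun hi => ⟨fun j => (hi j).2, rfl⟩, fun hi j => ⟨?_, hi.1 j⟩⟩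
    exact (h j).le.trans (hi.1 i₀)

lemma maximizers_bool_univ {ι : Type*} {f : ι × Bool → ℝ} {i₀ : ι}
    (hf : maximizers (fun i => f (i, true)) = maximizers (fun i => f (i, false)))
    (h0 : i₀ ∈ maximizers (fun i => f (i, false))) (h : f (i₀, true) = f (i₀, false)) :
    maximizers f = maximizers (fun i => f (i, false)) ×ˢ Set.univ := by
  have h1 : i₀ ∈ maximizers (fun i => f (i, true)) := hf ▸ h0
  ext ⟨i, b⟩
  simp only [Set.mem_prod, Set.mem_univ, and_true]
  constructor
  · intro hi
    cases b
    · exact fun j => hi (j, false)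
    · rw [← hf]
      exact fun j => hi (j, true)
  · intro hi
    have hi' : i ∈ maximizers (fun i => f (i, true)) := hf ▸ hi
    have e0 : f (i, false) = f (i₀, false) := le_antisymm (h0 i) (hi i₀)
    have e1 : f (i, true) = f (i₀, true) := le_antisymm (h1 i) (hi' i₀)
    rintro ⟨j, b'⟩
    have a0 := h0 j
    have a1 := h1 j
    simp only at a0 a1
    cases b <;> cases b' <;> linarith

/-- Adding `t` to the coefficients of a functional on the positions up to `lowerPt p`. -/
def shiftCoeff (p : Fin (n - 1)) (t : ℝ) (c : Fin n → ℝ) : Fin n → ℝ :=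
  fun i => c i + if i.val ≤ p.val then t else 0

/-- The entries in the first block are always the numbers up to `p`, so the shift adds the same
constant for every such `u`. Hence the shift parameter can be chosen freely without affecting the
maximizers. -/
lemma weightedSum_shiftCoeff (b : ℕ → ℝ) {p : Fin (n - 1)} (t : ℝ) (c : Fin n → ℝ)
    {u : Equiv.Perm (Fin n)} (hu : SplitsAt p u) :
    weightedSum b (shiftCoeff p t c) u =
      weightedSum b c u + t * ∑ i : Fin n, if i.val ≤ p.val then b i.val else 0 := by
  have e := Equiv.sum_comp u fun i : Fin n => if i.val ≤ p.val then b i.val else 0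
  unfold weightedSum shiftCoeff
  rw [← e, Finset.mul_sum, ← Finset.sum_add_distrib]
  refine Finset.sum_congr rfl fun i _ => ?_
  rw [if_congr (hu i) rfl rfl]
  split_ifs <;> ring

lemma maximizers_shiftCoeff {ι : Type*} {g : ι → Equiv.Perm (Fin n)} (b : ℕ → ℝ)
    {p : Fin (n - 1)} (t : ℝ) (c : Fin n → ℝ) (hg : ∀ i, SplitsAt p (g i)) :
    maximizers (fun i => weightedSum b (shiftCoeff p t c) (g i)) =
      maximizers (fun i => weightedSum b c (g i)) := by
  simp only [weightedSum_shiftCoeff b t c (hg _)]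
  exact maximizers_add_const _ _

/-- The doubling of a family of permutations by right multiplication with `s`. -/
def rightDouble {ι : Type*} (g : ι → Equiv.Perm (Fin n)) (s : Equiv.Perm (Fin n)) :
    ι × Bool → Equiv.Perm (Fin n) := fun x => if x.2 then g x.1 * s else g x.1

/-- The doubling of a family of permutations by left multiplication with `s`. -/
def leftDouble {ι : Type*} (g : ι → Equiv.Perm (Fin n)) (s : Equiv.Perm (Fin n)) :
    ι × Bool → Equiv.Perm (Fin n) := fun x => if x.2 then s * g x.1 else g x.1

/-- All `g i` ascend at `p`, so the sign of `c (lowerPt p) - c (upperPt p)` alone decides which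
layer wins, or that the layers tie. `shiftCoeff` realizes every sign over any given face of the
base. -/
lemma maximizerFamily_rightDouble {ι : Type*} [Finite ι] [Nonempty ι]
    {g : ι → Equiv.Perm (Fin n)} {p : Fin (n - 1)} (hg : ∀ i, SplitsAt p (g i)) :
    maximizerFamily (rightDouble g (simpleTransposition p)) = prismFamily (maximizerFamily g) := by
  set b : ℕ → ℝ := fun m => (m : ℝ)
  have hsymm : (simpleTransposition p).symm = simpleTransposition p := simpleTransposition_inv p
  set f : (Fin n → ℝ) → ι × Bool → ℝ := fun c x =>
    weightedSum b c (rightDouble g (simpleTransposition p) x) with hf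
  have f0 : ∀ c i, f c (i, false) = weightedSum b c (g i) := fun c i => by simp [hf, rightDouble]
  have f1 : ∀ c i, f c (i, true) = weightedSum b (c ∘ simpleTransposition p) (g i) := fun c i => by
    rw [← hsymm, ← weightedSum_mul]
    simp [hf, rightDouble]
  have f2 : ∀ c i, ∃ d > 0, f c (i, true) = f c (i, false) +
      (c (lowerPt p) - c (upperPt p)) * d := fun c i => by
    refine ⟨b (g i (upperPt p)).val - b (g i (lowerPt p)).val,
      sub_pos.2 (Nat.cast_lt.2 (Fin.lt_def.1 (hg i).ascent)), ?_⟩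
    rw [f0, ← weightedSum_mul_simpleTransposition]
    simp [hf, rightDouble]
  have hlt : ∀ c, c (lowerPt p) < c (upperPt p) →
      maximizers (f c) = maximizers (fun i => weightedSum b c (g i)) ×ˢ {false} := fun c hc => by
    obtain ⟨i₀, hi₀⟩ := maximizers_nonempty fun i => f c (i, false)
    rw [maximizers_bool_false (i₀ := i₀)]
    · simp only [f0]
    · intro i
      obtain ⟨d, hd, e⟩ := f2 c i
      have := hi₀ i
      simp only at this
      nlinarith
  have hgt : ∀ c, c (upperPt p) < c (lowerPt p) → maximizers (f c) =
      maximizers (fun i => weightedSum b (c ∘ simpleTransposition p) (g i)) ×ˢ {true} := by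
    intro c hc
    obtain ⟨i₀, hi₀⟩ := maximizers_nonempty fun i => f c (i, true)
    rw [maximizers_bool_true (i₀ := i₀)]
    · simp only [f1]
    · intro i
      obtain ⟨d, hd, e⟩ := f2 c i
      have := hi₀ i
      simp only at this
      nlinarith
  have heq : ∀ c, c (lowerPt p) = c (upperPt p) →
      maximizers (f c) = maximizers (fun i => weightedSum b c (g i)) ×ˢ Set.univ := fun c hc => by
    have e : ∀ i, f c (i, true) = f c (i, false) := fun i => by
      obtain ⟨d, -, e⟩ := f2 c i
      rw [e, hc]
      ring
    obtain ⟨i₀, hi₀⟩ := maximizers_nonempty fun i => f c (i, false)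
    rw [maximizers_bool_univ (by simp only [e]) hi₀ (e i₀)]
    simp only [f0]
  have hshift : ∀ (c : Fin n → ℝ) (d : ℝ), ∃ c' : Fin n → ℝ,
      c' (lowerPt p) - c' (upperPt p) = d ∧
        maximizers (fun i => weightedSum b c' (g i)) =
          maximizers (fun i => weightedSum b c (g i)) := fun c d => by
    refine ⟨shiftCoeff p (d - (c (lowerPt p) - c (upperPt p))) c, ?_,
      maximizers_shiftCoeff b _ c hg⟩
    simp only [shiftCoeff, val_lowerPt, val_upperPt, le_refl, if_true, add_le_iff_nonpos_right,
      nonpos_iff_eq_zero, one_ne_zero, if_false]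
    ring
  ext B
  constructor
  · rintro ⟨c, rfl⟩
    change maximizers (f c) ∈ _
    rcases lt_trichotomy (c (lowerPt p)) (c (upperPt p)) with hc | hc | hc
    · exact ⟨_, ⟨c, rfl⟩, Or.inl (hlt c hc)⟩
    · exact ⟨_, ⟨c, rfl⟩, Or.inr (Or.inr (heq c hc))⟩
    · exact ⟨_, ⟨_, rfl⟩, Or.inr (Or.inl (hgt c hc))⟩
  · rintro ⟨A, ⟨c, rfl⟩, rfl | rfl | rfl⟩
    · obtain ⟨c', hd, hc'⟩ := hshift c (-1)
      exact ⟨c', by rw [← hc']; exact (hlt c' (by linarith)).symm⟩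
    -- On the upper layer the base functional is `c' ∘ simpleTransposition p`, so `c'` is
    -- precomposed with the transposition, which also makes the difference positive.
    · obtain ⟨c', hd, hc'⟩ := hshift c (-1)
      refine ⟨c' ∘ simpleTransposition p, ?_⟩
      rw [← hc']
      refine Eq.trans ?_ (hgt _ ?_).symm
      · have : (c' ∘ simpleTransposition p) ∘ simpleTransposition p = c' := by
          ext i
          simp
        rw [this]
      · simp only [Function.comp_apply, simpleTransposition_lowerPt, simpleTransposition_upperPt]
        linarith
    · obtain ⟨c', hd, hc'⟩ := hshift c 0
      exact ⟨c', by rw [← hc']; exact (heq c' (by linarith)).symm⟩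

/-- The value of `simpleTransposition p` at `m`, as a real number. -/
noncomputable def swapWeight (p m : ℕ) : ℝ := if m = p then p + 1 else if m = p + 1 then p else m

/-- The only drop of `swapWeight` is from `p + 1` to `p`, so adding 2 beyond `p` restores strict
growth. -/
lemma strictMono_swapWeight_add (p : ℕ) :
    StrictMono fun m => swapWeight p m + if m ≤ p then (0 : ℝ) else 2 := by
  refine strictMono_nat_of_lt_succ fun m => ?_
  simp only [swapWeight]
  split_ifs <;> first | omega | skip
  all_goals subst_vars; push_cast; linarith

lemma weightedSum_simpleTransposition_mul (c : Fin n → ℝ) (u : Equiv.Perm (Fin n))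
    (p : Fin (n - 1)) :
    weightedSum (fun m => (m : ℝ)) c (simpleTransposition p * u) =
      weightedSum (swapWeight p.val) c u := by
  unfold weightedSum
  refine Finset.sum_congr rfl fun i _ => ?_
  simp only [Equiv.Perm.mul_apply, val_simpleTransposition_apply, swapWeight]
  split_ifs <;> simp

/-- The weights are not monotone. Adding 2 to the weights beyond `p` makes them so, and for
permutations splitting at `p` this changes the functional only by a constant. After that,
`maximizers_weightedSum_eq` applies. -/
lemma maximizers_swapWeight {ι : Type*} {g : ι → Equiv.Perm (Fin n)} {w : Equiv.Perm (Fin n)}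
    (hg : Set.range g = {u | BruhatLE u w}) {p : Fin (n - 1)} (hs : ∀ i, SplitsAt p (g i))
    (c : Fin n → ℝ) :
    maximizers (fun i => weightedSum (swapWeight p.val) c (g i)) =
      maximizers (fun i => weightedSum (fun m => (m : ℝ)) c (g i)) := by
  set b : ℕ → ℝ := fun m => swapWeight p.val m + if m ≤ p.val then 0 else 2
  have hb : StrictMono b := strictMono_swapWeight_add p.val
  rw [maximizers_weightedSum_eq hg c Nat.strictMono_cast hb,
    ← maximizers_add_const (fun i => weightedSum (swapWeight p.val) c (g i))
      (∑ i, c i * if i.val ≤ p.val then 0 else 2)]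
  congr 1
  ext i
  unfold weightedSum
  rw [← Finset.sum_add_distrib]
  refine Finset.sum_congr rfl fun j _ => ?_
  rw [← mul_add, ← if_congr (hs i j) rfl rfl]

/-- The excess of exactly 1 means that shifting the coefficients by `t` changes the gap between the
layers of a left doubling by exactly `t`. -/
lemma sum_swapWeight (p : Fin (n - 1)) :
    (∑ i : Fin n, if i.val ≤ p.val then swapWeight p.val i.val else 0) =
      (∑ i : Fin n, if i.val ≤ p.val then (i.val : ℝ) else 0) + 1 := by
  rw [← sub_eq_iff_eq_add', ← Finset.sum_sub_distrib, Fintype.sum_eq_single (lowerPt p)]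
  · simp [swapWeight]
  · intro i hi
    rw [Ne, Fin.ext_iff, val_lowerPt] at hi
    unfold swapWeight
    split_ifs <;> first | omega | simp

/-- The gap between the layers now varies with `i`, but both layers have the same maximizers. The
gap at one common maximizer therefore decides which layer wins, and `shiftCoeff` gives this gap any
prescribed value. -/
lemma maximizerFamily_leftDouble {ι : Type*} [Finite ι] [Nonempty ι]
    {g : ι → Equiv.Perm (Fin n)} {w : Equiv.Perm (Fin n)}
    (hgw : Set.range g = {u | BruhatLE u w}) {p : Fin (n - 1)} (hg : ∀ i, SplitsAt p (g i)) :
    maximizerFamily (leftDouble g (simpleTransposition p)) = prismFamily (maximizerFamily g) := by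
  set b : ℕ → ℝ := fun m => (m : ℝ)
  set f : (Fin n → ℝ) → ι × Bool → ℝ := fun c x =>
    weightedSum b c (leftDouble g (simpleTransposition p) x) with hf
  have f0 : ∀ c i, f c (i, false) = weightedSum b c (g i) := fun c i => by simp [hf, leftDouble]
  have f1 : ∀ c i, f c (i, true) = weightedSum (swapWeight p.val) c (g i) := fun c i => by
    rw [← weightedSum_simpleTransposition_mul]
    simp [hf, leftDouble, b]
  have f2 : ∀ c, maximizers (fun i => f c (i, true)) = maximizers (fun i => f c (i, false)) :=
    fun c => by
      simp only [f0, f1]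
      exact maximizers_swapWeight hgw hg c
  have main : ∀ c i₀, i₀ ∈ maximizers (fun i => f c (i, false)) →
      (f c (i₀, true) < f c (i₀, false) →
        maximizers (f c) = maximizers (fun i => weightedSum b c (g i)) ×ˢ {false}) ∧
      (f c (i₀, false) < f c (i₀, true) →
        maximizers (f c) = maximizers (fun i => weightedSum b c (g i)) ×ˢ {true}) ∧
      (f c (i₀, true) = f c (i₀, false) →
        maximizers (f c) = maximizers (fun i => weightedSum b c (g i)) ×ˢ Set.univ) := by
    intro c i₀ h0
    have h1 : i₀ ∈ maximizers (fun i => f c (i, true)) := f2 c ▸ h0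
    simp only [← f0]
    refine ⟨fun h => maximizers_bool_false fun i => (h1 i).trans_lt h, fun h => ?_,
      fun h => maximizers_bool_univ (f2 c) h0 h⟩
    rw [← f2 c]
    exact maximizers_bool_true fun i => (h0 i).trans_lt h
  have hshift : ∀ (c : Fin n → ℝ) (i₀ : ι) (d : ℝ), ∃ c' : Fin n → ℝ,
      f c' (i₀, true) = f c' (i₀, false) + d ∧
        maximizers (fun i => weightedSum b c' (g i)) =
          maximizers (fun i => weightedSum b c (g i)) := fun c i₀ d => by
    refine ⟨shiftCoeff p (d - (f c (i₀, true) - f c (i₀, false))) c, ?_,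
      maximizers_shiftCoeff b _ c hg⟩
    rw [f0, f1, f0, f1, weightedSum_shiftCoeff _ _ _ (hg _), weightedSum_shiftCoeff _ _ _ (hg _),
      sum_swapWeight]
    ring
  ext B
  constructor
  · rintro ⟨c, rfl⟩
    change maximizers (f c) ∈ _
    obtain ⟨i₀, hi₀⟩ := maximizers_nonempty fun i => f c (i, false)
    obtain ⟨m1, m2, m3⟩ := main c i₀ hi₀
    rcases lt_trichotomy (f c (i₀, true)) (f c (i₀, false)) with hc | hc | hc
    · exact ⟨_, ⟨c, rfl⟩, Or.inl (m1 hc)⟩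
    · exact ⟨_, ⟨c, rfl⟩, Or.inr (Or.inr (m3 hc))⟩
    · exact ⟨_, ⟨c, rfl⟩, Or.inr (Or.inl (m2 hc))⟩
  · rintro ⟨A, ⟨c, rfl⟩, hB⟩
    obtain ⟨i₀, hi₀⟩ := maximizers_nonempty fun i => weightedSum b c (g i)
    have hmain : ∀ d, ∃ c' : Fin n → ℝ, f c' (i₀, true) = f c' (i₀, false) + d ∧
        maximizers (fun i => weightedSum b c' (g i)) =
          maximizers (fun i => weightedSum b c (g i)) ∧
        i₀ ∈ maximizers (fun i => f c' (i, false)) := fun d => by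
      obtain ⟨c', hd, hc'⟩ := hshift c i₀ d
      refine ⟨c', hd, hc', ?_⟩
      simp only [f0]
      rwa [hc']
    rcases hB with rfl | rfl | rfl
    · obtain ⟨c', hd, hc', h0⟩ := hmain (-1)
      exact ⟨c', by rw [← hc']; exact ((main c' i₀ h0).1 (by linarith)).symm⟩
    · obtain ⟨c', hd, hc', h0⟩ := hmain 1
      exact ⟨c', by rw [← hc']; exact ((main c' i₀ h0).2.1 (by linarith)).symm⟩
    · obtain ⟨c', hd, hc', h0⟩ := hmain 0
      exact ⟨c', by rw [← hc']; exact ((main c' i₀ h0).2.2 (by linarith)).symm⟩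

end MaximizerFamilies

/-! ### From faces of a polytope to families of maximizer sets. -/

section FaceLattice

variable {n : ℕ}

/-- By Krein–Milman a face is the closed hull of its extreme points. These are extreme in the whole
polytope, hence among the generating points. -/
lemma IsExposed.eq_convexHull_image {ι E : Type*} [Finite ι] [NormedAddCommGroup E]
    [NormedSpace ℝ E] {x : ι → E} {F : Set E} (hF : IsExposed ℝ (convexHull ℝ (Set.range x)) F) :
    F = convexHull ℝ (x '' {i | x i ∈ F}) := by
  have hP : IsCompact (convexHull ℝ (Set.range x)) := (Set.finite_range x).isCompact_convexHull ℝ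
  have hFc : Convex ℝ F := hF.convex (convex_convexHull ℝ _)
  refine Set.Subset.antisymm ?_ (convexHull_min (by rintro _ ⟨i, hi, rfl⟩; exact hi) hFc)
  have hfin : (x '' {i | x i ∈ F}).Finite := Set.toFinite _
  have hext : Set.extremePoints ℝ F ⊆ x '' {i | x i ∈ F} := fun y hy => by
    obtain ⟨i, rfl⟩ := extremePoints_convexHull_subset
      (hF.isExtreme.extremePoints_subset_extremePoints hy)
    exact ⟨i, hy.1, rfl⟩
  calc F = closure (convexHull ℝ (Set.extremePoints ℝ F)) :=
        (closure_convexHull_extremePoints (hF.isCompact hP) hFc).symm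
    _ ⊆ closure (convexHull ℝ (x '' {i | x i ∈ F})) := closure_mono (convexHull_mono hext)
    _ = convexHull ℝ (x '' {i | x i ∈ F}) := (hfin.isClosed_convexHull ℝ).closure_eq

lemma setOf_mem_toExposed_eq_maximizers {ι E : Type*} [AddCommGroup E] [Module ℝ E]
    [TopologicalSpace E] (x : ι → E) (l : StrongDual ℝ E) :
    {i | x i ∈ l.toExposed (convexHull ℝ (Set.range x))} = maximizers fun i => l (x i) := by
  ext i
  refine ⟨fun hi j => hi.2 _ (subset_convexHull ℝ _ ⟨j, rfl⟩), fun hi => ?_⟩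
  refine ⟨subset_convexHull ℝ _ ⟨i, rfl⟩, fun y hy => ?_⟩
  have hsub : convexHull ℝ (Set.range x) ⊆ {y | l y ≤ l (x i)} :=
    convexHull_min (by rintro _ ⟨j, rfl⟩; exact hi j)
      (convex_halfSpace_le l.toLinearMap.isLinear _)
  exact hsub hy

lemma strongDual_permPoint (l : StrongDual ℝ (Fin n → ℝ)) (u : Equiv.Perm (Fin n)) :
    l (permPoint u) = weightedSum (fun m => (m : ℝ)) (fun i => l (Pi.single i 1)) u +
      ∑ i, l (Pi.single i 1) := by
  have h : permPoint u = ∑ i, permPoint u i • (Pi.single i 1 : Fin n → ℝ) :=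
    pi_eq_sum_univ' _
  rw [h, map_sum, weightedSum, ← Finset.sum_add_distrib]
  refine Finset.sum_congr rfl fun i _ => ?_
  rw [map_smul, smul_eq_mul, permPoint]
  ring

lemma mem_maximizerFamily_iff {ι : Type*} {g : ι → Equiv.Perm (Fin n)} {A : Set ι} :
    A ∈ maximizerFamily g ↔
      ∃ l : StrongDual ℝ (Fin n → ℝ), A = maximizers fun i => l (permPoint (g i)) := by
  constructor
  · rintro ⟨c, rfl⟩
    refine ⟨∑ i, c i • ContinuousLinearMap.proj i, ?_⟩
    -- The constant accounts for the `+ 1` in `permPoint`.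
    rw [← maximizers_add_const _ (∑ i, c i)]
    congr 1
    ext i
    simp [weightedSum, permPoint, mul_add, Finset.sum_add_distrib]
  · rintro ⟨l, rfl⟩
    refine ⟨fun i => l (Pi.single i 1), ?_⟩
    simp only [strongDual_permPoint]
    exact maximizers_add_const _ _

/-- The face lattice of the convex hull of the points of a family of permutations is the family
of the sets of maximizers, together with the empty set. -/
lemma exists_polytopeFace_orderIso {ι : Type*} [Finite ι] [Nonempty ι]
    (g : ι → Equiv.Perm (Fin n)) :
    Nonempty (PolytopeFace (convexHull ℝ (Set.range fun i => permPoint (g i))) ≃o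
      {A : Set ι // A = ∅ ∨ A ∈ maximizerFamily g}) := by
  set x : ι → Fin n → ℝ := fun i => permPoint (g i) with hx
  have hmem : ∀ F : PolytopeFace (convexHull ℝ (Set.range x)),
      {i | x i ∈ F.1} = ∅ ∨ {i | x i ∈ F.1} ∈ maximizerFamily g := by
    rintro ⟨F, hF⟩
    rcases F.eq_empty_or_nonempty with rfl | hne
    · left
      simp
    · right
      obtain ⟨l, hl⟩ := hF hne
      rw [mem_maximizerFamily_iff]
      refine ⟨l, Eq.trans ?_ (setOf_mem_toExposed_eq_maximizers x l)⟩
      subst hl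
      rfl
  let e : PolytopeFace (convexHull ℝ (Set.range x)) ↪o
      {A : Set ι // A = ∅ ∨ A ∈ maximizerFamily g} :=
    OrderEmbedding.ofMapLEIff (fun F => ⟨{i | x i ∈ F.1}, hmem F⟩) fun F G => by
      refine ⟨fun h => ?_, fun h i hi => h hi⟩
      change F.1 ⊆ G.1
      rw [F.2.eq_convexHull_image, G.2.eq_convexHull_image]
      exact convexHull_mono (Set.image_mono h)
  refine ⟨RelIso.ofSurjective e ?_⟩
  rintro ⟨A, rfl | hA⟩
  -- The empty set is exposed vacuously: a functional is required only for nonempty faces.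
  · exact ⟨⟨∅, fun h => absurd h Set.not_nonempty_empty⟩, Subtype.ext (by simp [e])⟩
  · obtain ⟨l, rfl⟩ := mem_maximizerFamily_iff.1 hA
    exact ⟨⟨l.toExposed _, ContinuousLinearMap.toExposed.isExposed⟩,
      Subtype.ext (setOf_mem_toExposed_eq_maximizers x l)⟩

lemma bruhatIntervalPolytope_one_eq {ι : Type*} {g : ι → Equiv.Perm (Fin n)}
    {w : Equiv.Perm (Fin n)} (hg : Set.range g = {u | BruhatLE u w}) :
    bruhatIntervalPolytope 1 w = convexHull ℝ (Set.range fun i => permPoint (g i)) := by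
  unfold bruhatIntervalPolytope
  congr 1
  ext y
  constructor
  · rintro ⟨u, -, hu, rfl⟩
    obtain ⟨i, rfl⟩ := (Set.ext_iff.1 hg u).2 hu
    exact ⟨i, rfl⟩
  · rintro ⟨i, rfl⟩
    exact ⟨g i, one_bruhatLE _, (Set.ext_iff.1 hg _).1 ⟨i, rfl⟩, rfl⟩

lemma combinatoriallyEquivalent_of_maximizerFamily_eq {ι : Type*} [Finite ι] [Nonempty ι]
    {g g' : ι → Equiv.Perm (Fin n)} {w w' : Equiv.Perm (Fin n)}
    (hg : Set.range g = {u | BruhatLE u w}) (hg' : Set.range g' = {u | BruhatLE u w'})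
    (h : maximizerFamily g = maximizerFamily g') :
    CombinatoriallyEquivalent (bruhatIntervalPolytope 1 w) (bruhatIntervalPolytope 1 w') := by
  rw [bruhatIntervalPolytope_one_eq hg, bruhatIntervalPolytope_one_eq hg']
  obtain ⟨e⟩ := exists_polytopeFace_orderIso g
  obtain ⟨e'⟩ := exists_polytopeFace_orderIso g'
  rw [h] at e
  exact ⟨e.trans e'.symm⟩

end FaceLattice

/-! ### Pattern occurrences, cuts, and permutations whose descents lie in one occurrence. -/

section Patterns

variable {n : ℕ}

lemma inversionCount_inv (w : Equiv.Perm (Fin n)) : inversionCount w⁻¹ = inversionCount w := by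
  have h : ∀ w : Equiv.Perm (Fin n), inversionCount w⁻¹ ≤ inversionCount w := fun w => by
    obtain ⟨ω, rfl, h⟩ := exists_wordProd_eq w
    rw [← h, ← wordProd_reverse, ← List.length_reverse]
    exact inversionCount_wordProd_le _
  exact le_antisymm (h w) (by simpa using h w⁻¹)

lemma exists_descent_between {w : Equiv.Perm (Fin n)} {a b : Fin n} (hab : a < b)
    (hw : w b < w a) :
    ∃ p : Fin (n - 1), w (upperPt p) < w (lowerPt p) ∧ a ≤ lowerPt p ∧ upperPt p ≤ b := by
  by_contra! h
  have key : ∀ k : ℕ, ∀ c : Fin n, c.val = a.val + k → c ≤ b → w a ≤ w c := by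
    intro k
    induction k with
    | zero =>
      intro c hc _
      exact (congrArg w (Fin.ext hc)).ge
    | succ k ih =>
      intro c hc hcb
      rw [Fin.le_def] at hcb
      let p : Fin (n - 1) := ⟨a.val + k, by omega⟩
      have hu : upperPt p = c := Fin.ext (by simp [p]; omega)
      have hl := ih (lowerPt p) rfl (by rw [Fin.le_def]; simp only [val_lowerPt, p]; omega)
      refine hl.trans (not_lt.1 fun hd => ?_)
      have := h p (by rwa [hu]) (by rw [Fin.le_def]; simp [p])
      rw [hu] at this
      exact absurd this (not_lt.2 hcb)
  exact absurd (key (b.val - a.val) b (by rw [Fin.lt_def] at hab; omega) le_rfl) hw.not_ge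

lemma le_apply_of_increasing {w : Equiv.Perm (Fin n)} {a : Fin n}
    (h : ∀ x y, x < y → y ≤ a → w x < w y) (x : Fin n) (hx : x ≤ a) : x ≤ w x := by
  induction hk : x.val generalizing x with
  | zero => rw [Fin.le_def]; omega
  | succ k ih =>
    rw [Fin.le_def] at hx
    obtain ⟨y, hy⟩ : ∃ y : Fin n, y.val = k := ⟨⟨k, by omega⟩, rfl⟩
    have h1 := ih y (by rw [Fin.le_def]; omega) hy
    have h2 := h y x (by rw [Fin.lt_def]; omega) hx
    rw [Fin.le_def] at h1 ⊢
    rw [Fin.lt_def] at h2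
    omega

lemma apply_le_of_increasing {w : Equiv.Perm (Fin n)} {a : Fin n}
    (h : ∀ x y, x < y → a ≤ x → w x < w y) (x : Fin n) (hx : a ≤ x) : w x ≤ x := by
  induction hk : n - 1 - x.val generalizing x with
  | zero => rw [Fin.le_def]; omega
  | succ k ih =>
    rw [Fin.le_def] at hx
    obtain ⟨y, hy⟩ : ∃ y : Fin n, y.val = x.val + 1 := ⟨⟨x.val + 1, by omega⟩, rfl⟩
    have h1 := ih y (by rw [Fin.le_def]; omega) (by omega)
    have h2 := h x y (by rw [Fin.lt_def]; omega) hx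
    rw [Fin.le_def] at h1 ⊢
    rw [Fin.lt_def] at h2
    omega

/-- No occurrence of the pattern `q` in `w` uses both points moved by `simpleTransposition p`. -/
def NotUsed {k : ℕ} (q : Equiv.Perm (Fin k)) (w : Equiv.Perm (Fin n)) (p : Fin (n - 1)) : Prop :=
  ∀ f, IsPatternOccurrence q w f → ¬ (lowerPt p ∈ Set.range f ∧ upperPt p ∈ Set.range f)

lemma NotUsed.strictMono {k : ℕ} {q : Equiv.Perm (Fin k)} {w : Equiv.Perm (Fin n)}
    {p : Fin (n - 1)} (h : NotUsed q w p) {f : Fin k ↪o Fin n}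
    (hf : IsPatternOccurrence q w f) : StrictMono fun i => simpleTransposition p (f i) := by
  intro i j hij
  refine (simpleTransposition_lt_iff p _ _ ?_ ?_).2 (f.strictMono hij)
  · rintro ⟨h1, h2⟩
    exact h f hf ⟨⟨i, h1⟩, ⟨j, h2⟩⟩
  · rintro ⟨h1, h2⟩
    exact h f hf ⟨⟨j, h2⟩, ⟨i, h1⟩⟩

/-- Moving the positions of an occurrence by the transposition keeps them in increasing order as
long as both exchanged positions are never used together. This gives a bijection of occurrences. -/
lemma patternCount_mul_of_notUsed {k : ℕ} {q : Equiv.Perm (Fin k)} {w : Equiv.Perm (Fin n)}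
    {p : Fin (n - 1)} (h : NotUsed q w p) (h' : NotUsed q (w * simpleTransposition p) p) :
    patternCount q (w * simpleTransposition p) = patternCount q w := by
  refine Nat.card_congr
    ⟨fun f => ⟨OrderEmbedding.ofStrictMono _ (h'.strictMono f.2), fun a b => ?_⟩,
      fun f => ⟨OrderEmbedding.ofStrictMono _ (h.strictMono f.2), fun a b => ?_⟩,
      fun f => ?_, fun f => ?_⟩
  · exact f.2 a b
  · simpa using f.2 a b
  · ext i
    simp
  · ext i
    simp

/-- An occurrence using both points starts at or before the cut and ends after it, so its last entry
exceeds its first. Both `321` and `3412` end below their first entry. -/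
lemma SplitsAt.notUsed {k : ℕ} {q : Equiv.Perm (Fin (k + 1))} (hq : q (Fin.last k) < q 0)
    {w : Equiv.Perm (Fin n)} {p : Fin (n - 1)} (hw : SplitsAt p w) : NotUsed q w p := by
  rintro f hf ⟨⟨i, hi⟩, ⟨j, hj⟩⟩
  have h1 : w (f (Fin.last k)) < w (f 0) := (hf _ _).2 hq
  have h2 := f.monotone (Fin.zero_le i)
  have h3 := f.monotone (Fin.le_last j)
  rw [hi, Fin.le_def, val_lowerPt] at h2
  rw [hj, Fin.le_def, val_upperPt] at h3
  exact absurd h1 (hw.lt h2 (by omega)).not_gt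

/-- The values of an occurrence in `w`, in increasing order, are the positions of an occurrence of
the inverse pattern in `w⁻¹`. -/
lemma patternCount_inv {k : ℕ} (q : Equiv.Perm (Fin k)) (w : Equiv.Perm (Fin n)) :
    patternCount q⁻¹ w⁻¹ = patternCount q w := by
  have key : ∀ {q : Equiv.Perm (Fin k)} {w : Equiv.Perm (Fin n)} {f : Fin k ↪o Fin n},
      IsPatternOccurrence q w f → StrictMono fun i => w (f (q⁻¹ i)) := by
    intro q w f hf i j hij
    refine (hf _ _).2 ?_
    simpa using hij
  refine Nat.card_congr
    ⟨fun f => ⟨OrderEmbedding.ofStrictMono _ (key f.2), fun a b => ?_⟩,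
      fun f => ⟨OrderEmbedding.ofStrictMono _ (key f.2), fun a b => ?_⟩,
      fun f => ?_, fun f => ?_⟩
  · simp
  · simp
  · ext i
    simp
  · ext i
    simp

lemma pattern321_inv : pattern321⁻¹ = pattern321 := by decide

lemma pattern3412_inv : pattern3412⁻¹ = pattern3412 := by decide

lemma count321And3412_inv (w : Equiv.Perm (Fin n)) :
    count321And3412 w⁻¹ = count321And3412 w := by
  unfold count321And3412
  rw [← patternCount_inv pattern321 w, ← patternCount_inv pattern3412 w, pattern321_inv,
    pattern3412_inv]

lemma exists_isPatternOccurrence_321 {w : Equiv.Perm (Fin n)} {a b c : Fin n} (hab : a < b)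
    (hbc : b < c) (h1 : w b < w a) (h2 : w c < w b) :
    ∃ f, IsPatternOccurrence pattern321 w f ∧ f 0 = a ∧ f 1 = b ∧ f 2 = c := by
  have hf : StrictMono ![a, b, c] := by
    rw [Fin.strictMono_iff_lt_succ]
    intro i
    fin_cases i
    · exact hab
    · exact hbc
  refine ⟨OrderEmbedding.ofStrictMono _ hf, ?_, rfl, rfl, rfl⟩
  have h3 := h2.trans h1
  intro i j
  fin_cases i <;> fin_cases j <;>
    simp [pattern321, h1, h2, h3, h1.le, h2.le, h3.le]

lemma exists_isPatternOccurrence_3412 {w : Equiv.Perm (Fin n)} {a b c d : Fin n} (hab : a < b)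
    (hbc : b < c) (hcd : c < d) (h1 : w c < w d) (h2 : w d < w a) (h3 : w a < w b) :
    ∃ f, IsPatternOccurrence pattern3412 w f ∧ f 0 = a ∧ f 1 = b ∧ f 2 = c ∧ f 3 = d := by
  have hf : StrictMono ![a, b, c, d] := by
    rw [Fin.strictMono_iff_lt_succ]
    intro i
    fin_cases i
    · exact hab
    · exact hbc
    · exact hcd
  refine ⟨OrderEmbedding.ofStrictMono _ hf, ?_, rfl, rfl, rfl, rfl⟩
  have h4 := h1.trans h2
  have h5 := h2.trans h3
  have h6 := h4.trans h3
  intro i j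
  fin_cases i <;> fin_cases j <;>
    simp [pattern3412, h1, h2, h3, h4, h5, h6, h1.le, h2.le, h3.le, h4.le, h5.le, h6.le]

/-- A descent that is used by no occurrence of `321` or `3412` is a cut. -/
lemma splitsAt_mul_of_notUsed {w : Equiv.Perm (Fin n)} {p : Fin (n - 1)}
    (hp : w (upperPt p) < w (lowerPt p)) (h3 : NotUsed pattern321 w p)
    (h4 : NotUsed pattern3412 w p) : SplitsAt p (w * simpleTransposition p) := by
  have hlt : ∀ x y : Fin n, x.val ≤ p.val → p.val < y.val →
      (w * simpleTransposition p) x < (w * simpleTransposition p) y := by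
    -- A violation of `hbefore` or `hafter` gives a `321` through the descent. Given these two, a
    -- violation of `hcross` gives a `3412` with the descent in the middle.
    have hbefore : ∀ x, x < lowerPt p → w x < w (lowerPt p) := fun x hx => by
      refine (lt_or_gt_of_ne (w.injective.ne hx.ne)).resolve_right fun h => ?_
      obtain ⟨f, hf, -, h1, h2⟩ := exists_isPatternOccurrence_321 hx (lowerPt_lt_upperPt p) h hp
      exact h3 f hf ⟨⟨1, h1⟩, ⟨2, h2⟩⟩
    have hafter : ∀ y, upperPt p < y → w (upperPt p) < w y := fun y hy => by
      refine (lt_or_gt_of_ne (w.injective.ne hy.ne)).resolve_right fun h => ?_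
      obtain ⟨f, hf, h0, h1, -⟩ := exists_isPatternOccurrence_321 (lowerPt_lt_upperPt p) hy hp h
      exact h3 f hf ⟨⟨0, h0⟩, ⟨1, h1⟩⟩
    have hcross : ∀ x y, x < lowerPt p → upperPt p < y → w x < w y := fun x y hx hy => by
      refine (lt_or_gt_of_ne (w.injective.ne
        (hx.trans ((lowerPt_lt_upperPt p).trans hy)).ne)).resolve_right fun h => ?_
      obtain ⟨f, hf, -, h1, h2, -⟩ := exists_isPatternOccurrence_3412 hx (lowerPt_lt_upperPt p) hy
        (hafter y hy) h (hbefore x hx)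
      exact h4 f hf ⟨⟨1, h1⟩, ⟨2, h2⟩⟩
    intro x y hx hy
    simp only [Equiv.Perm.mul_apply]
    have hx' : x = lowerPt p ∨ (x < lowerPt p ∧ simpleTransposition p x = x) := by
      rcases hx.eq_or_lt with h | h
      · exact Or.inl (Fin.ext h)
      · refine Or.inr ⟨h, Fin.ext ?_⟩
        rw [val_simpleTransposition_apply]
        split_ifs <;> omega
    have hy' : y = upperPt p ∨ (upperPt p < y ∧ simpleTransposition p y = y) := by
      rcases (Nat.succ_le_of_lt hy).eq_or_lt with h | h
      · exact Or.inl (Fin.ext h.symm)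
      · refine Or.inr ⟨h, Fin.ext ?_⟩
        rw [val_simpleTransposition_apply]
        split_ifs <;> omega
    rcases hx' with rfl | ⟨hx', ex⟩ <;> rcases hy' with rfl | ⟨hy', ey⟩
    · simpa using hp
    · rw [ey, simpleTransposition_lowerPt]
      exact hafter y hy'
    · rw [ex, simpleTransposition_upperPt]
      exact hbefore x hx'
    · rw [ex, ey]
      exact hcross x y hx' hy'
  refine splitsAt_of_forall_le fun a ha => ?_
  by_contra hb
  set v := w * simpleTransposition p
  -- All entries after the cut exceed `v a`. If `v a` itself lay beyond `p`, fewer values would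
  -- exceed it than there are positions after the cut.
  have hsub : (Finset.univ.filter fun y : Fin n => p.val < y.val).map v.toEmbedding ⊆
      Finset.univ.filter fun y : Fin n => v a < y := by
    intro z hz
    simp only [Finset.mem_map, Finset.mem_filter, Finset.mem_univ, true_and,
      Equiv.coe_toEmbedding] at hz ⊢
    obtain ⟨y, hy, rfl⟩ := hz
    exact hlt a y ha hy
  have h1 := Finset.card_le_card hsub
  rw [Finset.card_map] at h1
  have h2 : (Finset.univ.filter fun y : Fin n => v a < y) ⊂
      Finset.univ.filter fun y : Fin n => p.val < y.val := by
    rw [Finset.ssubset_iff_of_subset]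
    · exact ⟨v a, by simpa using hb, by simp⟩
    · intro y
      simp only [Finset.mem_filter, Finset.mem_univ, true_and, Fin.lt_def]
      omega
  have h3 := Finset.card_lt_card h2
  omega

lemma count321And3412_mul_of_notUsed {w : Equiv.Perm (Fin n)} {p : Fin (n - 1)}
    (hp : w (upperPt p) < w (lowerPt p)) (h3 : NotUsed pattern321 w p)
    (h4 : NotUsed pattern3412 w p) :
    count321And3412 (w * simpleTransposition p) = count321And3412 w := by
  have hs := splitsAt_mul_of_notUsed hp h3 h4
  unfold count321And3412
  rw [patternCount_mul_of_notUsed h3 (hs.notUsed (by decide)),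
    patternCount_mul_of_notUsed h4 (hs.notUsed (by decide))]

/-- `a < b < c` is an occurrence of `321` in `w` that contains all descents. -/
structure IsCore321 (w : Equiv.Perm (Fin n)) (a b c : Fin n) : Prop where
  lt_ab : a < b
  lt_bc : b < c
  apply_lt_ba : w b < w a
  apply_lt_cb : w c < w b
  descent : ∀ p : Fin (n - 1), w (upperPt p) < w (lowerPt p) →
    (lowerPt p = a ∨ lowerPt p = b ∨ lowerPt p = c) ∧
      (upperPt p = a ∨ upperPt p = b ∨ upperPt p = c)

namespace IsCore321

variable {w : Equiv.Perm (Fin n)} {a b c : Fin n}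

lemma val_b (h : IsCore321 w a b c) : b.val = a.val + 1 := by
  obtain ⟨p, hp, h1, h2⟩ := exists_descent_between h.lt_ab h.apply_lt_ba
  have h3 := h.descent p hp
  have h4 := h.lt_ab
  have h5 := h.lt_bc
  simp only [Fin.le_def, Fin.lt_def, Fin.ext_iff, val_lowerPt, val_upperPt] at *
  omega

lemma val_c (h : IsCore321 w a b c) : c.val = b.val + 1 := by
  obtain ⟨p, hp, h1, h2⟩ := exists_descent_between h.lt_bc h.apply_lt_cb
  have h3 := h.descent p hp
  have h4 := h.lt_ab
  have h5 := h.lt_bc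
  simp only [Fin.le_def, Fin.lt_def, Fin.ext_iff, val_lowerPt, val_upperPt] at *
  omega

lemma increasing_left (h : IsCore321 w a b c) (x y : Fin n) (hxy : x < y) (hy : y ≤ a) :
    w x < w y := by
  refine (lt_or_gt_of_ne (w.injective.ne hxy.ne)).resolve_right fun hlt => ?_
  obtain ⟨p, hp, h1, h2⟩ := exists_descent_between hxy hlt
  have h3 := h.descent p hp
  have h4 := h.lt_ab
  have h5 := h.lt_bc
  simp only [Fin.le_def, Fin.lt_def, Fin.ext_iff, val_lowerPt, val_upperPt] at *
  omega

lemma increasing_right (h : IsCore321 w a b c) (x y : Fin n) (hxy : x < y) (hx : c ≤ x) :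
    w x < w y := by
  refine (lt_or_gt_of_ne (w.injective.ne hxy.ne)).resolve_right fun hlt => ?_
  obtain ⟨p, hp, h1, h2⟩ := exists_descent_between hxy hlt
  have h3 := h.descent p hp
  have h4 := h.lt_ab
  have h5 := h.lt_bc
  simp only [Fin.le_def, Fin.lt_def, Fin.ext_iff, val_lowerPt, val_upperPt] at *
  omega

/-- All descents of `w` and of `w⁻¹` lie in the core, so the three positions and the three values
are consecutive and both permutations increase on each side. Increasing on an initial segment gives
`x ≤ w x`, and the same for the inverse gives `w x ≤ x`; the right side is dual. Thus `w` fixes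
everything outside the core and reverses the core. -/
lemma inv_eq (h : IsCore321 w a b c) (h' : IsCore321 w⁻¹ (w c) (w b) (w a)) : w⁻¹ = w := by
  have hb := h.val_b
  have hc := h.val_c
  have hb' := h'.val_b
  have hc' := h'.val_c
  have fix : ∀ x, x ≠ a → x ≠ b → x ≠ c → w x = x := by
    intro x ha hb hc
    have : x < a ∨ c < x := by
      simp only [Fin.lt_def, ne_eq, Fin.ext_iff] at *
      omega
    have n2 := w.injective.ne hb
    have n3 := w.injective.ne hc
    rcases this with hx | hx
    · refine le_antisymm ?_ (le_apply_of_increasing h.increasing_left x hx.le)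
      have h1 := h.increasing_left x a hx le_rfl
      simpa using le_apply_of_increasing h'.increasing_left (w x) (by
        simp only [Fin.lt_def, Fin.le_def, ne_eq, Fin.ext_iff] at *
        omega)
    · refine le_antisymm (apply_le_of_increasing h.increasing_right x hx.le) ?_
      have h1 := h.increasing_right c x hx le_rfl
      have n1 := w.injective.ne ha
      simpa using apply_le_of_increasing h'.increasing_right (w x) (by
        simp only [Fin.lt_def, Fin.le_def, ne_eq, Fin.ext_iff] at *
        omega)
  have mem : ∀ x, x = a ∨ x = b ∨ x = c → w x = a ∨ w x = b ∨ w x = c := by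
    intro x hx
    by_contra! hn
    have := w.injective (fix (w x) hn.1 hn.2.1 hn.2.2)
    rw [this] at hn
    tauto
  have ma := mem a (by simp)
  have mb := mem b (by simp)
  have mc := mem c (by simp)
  have l1 := h.apply_lt_ba
  have l2 := h.apply_lt_cb
  have wa : w a = c := by
    simp only [Fin.lt_def, Fin.ext_iff] at *
    omega
  have wb : w b = b := by
    simp only [Fin.lt_def, Fin.ext_iff] at *
    omega
  have wc : w c = a := by
    simp only [Fin.lt_def, Fin.ext_iff] at *
    omega
  rw [inv_eq_iff_mul_eq_one]
  ext x : 1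
  rw [Equiv.Perm.mul_apply, Equiv.Perm.one_apply]
  by_cases ha : x = a
  · rw [ha, wa, wc]
  by_cases hb : x = b
  · rw [hb, wb, wb]
  by_cases hc : x = c
  · rw [hc, wc, wa]
  rw [fix x ha hb hc, fix x ha hb hc]

end IsCore321

/-- `a < b < c < d` is an occurrence of `3412` in `w` that contains all descents. -/
structure IsCore3412 (w : Equiv.Perm (Fin n)) (a b c d : Fin n) : Prop where
  lt_ab : a < b
  lt_bc : b < c
  lt_cd : c < d
  apply_lt_cd : w c < w d
  apply_lt_da : w d < w a
  apply_lt_ab : w a < w b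
  descent : ∀ p : Fin (n - 1), w (upperPt p) < w (lowerPt p) →
    (lowerPt p = a ∨ lowerPt p = b ∨ lowerPt p = c ∨ lowerPt p = d) ∧
      (upperPt p = a ∨ upperPt p = b ∨ upperPt p = c ∨ upperPt p = d)

namespace IsCore3412

variable {w : Equiv.Perm (Fin n)} {a b c d : Fin n}

/-- The pairs `a, b` and `c, d` are ascents, so the middle pair is the only possible descent. -/
lemma eq_of_descent (h : IsCore3412 w a b c d) {p : Fin (n - 1)}
    (hp : w (upperPt p) < w (lowerPt p)) : lowerPt p = b ∧ upperPt p = c := by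
  have h1 := h.lt_ab
  have h2 := h.lt_bc
  have h3 := h.lt_cd
  have h4 := h.apply_lt_cd
  have h5 := h.apply_lt_ab
  obtain ⟨hl, hu⟩ := h.descent p hp
  have h6 : ¬ (lowerPt p = a ∧ upperPt p = b) := by
    rintro ⟨e1, e2⟩
    rw [e1, e2] at hp
    exact absurd hp h5.not_gt
  have h7 : ¬ (lowerPt p = c ∧ upperPt p = d) := by
    rintro ⟨e1, e2⟩
    rw [e1, e2] at hp
    exact absurd hp h4.not_gt
  clear hp h4 h5
  simp only [Fin.lt_def, Fin.ext_iff, val_lowerPt, val_upperPt] at *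
  omega

lemma val_c (h : IsCore3412 w a b c d) : c.val = b.val + 1 := by
  obtain ⟨p, hp, -, -⟩ := exists_descent_between h.lt_bc
    (h.apply_lt_cd.trans (h.apply_lt_da.trans h.apply_lt_ab))
  obtain ⟨rfl, rfl⟩ := h.eq_of_descent hp
  rfl

lemma increasing_left (h : IsCore3412 w a b c d) (x y : Fin n) (hxy : x < y) (hy : y ≤ b) :
    w x < w y := by
  refine (lt_or_gt_of_ne (w.injective.ne hxy.ne)).resolve_right fun hlt => ?_
  obtain ⟨p, hp, h1, h2⟩ := exists_descent_between hxy hlt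
  obtain ⟨rfl, rfl⟩ := h.eq_of_descent hp
  exact absurd (h2.trans hy) h.lt_bc.not_ge

lemma increasing_right (h : IsCore3412 w a b c d) (x y : Fin n) (hxy : x < y) (hx : c ≤ x) :
    w x < w y := by
  refine (lt_or_gt_of_ne (w.injective.ne hxy.ne)).resolve_right fun hlt => ?_
  obtain ⟨p, hp, h1, h2⟩ := exists_descent_between hxy hlt
  obtain ⟨rfl, rfl⟩ := h.eq_of_descent hp
  exact absurd (hx.trans h1) h.lt_bc.not_ge

/-- The argument is that for `321`, but the core forces only `c = b + 1` and `w a = w d + 1`. The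
remaining adjacencies of positions are hypotheses, supplied later by uniqueness of the occurrence.
-/
lemma inv_eq (h : IsCore3412 w a b c d) (h' : IsCore3412 w⁻¹ (w c) (w d) (w a) (w b))
    (hab : b.val = a.val + 1) (hcd : d.val = c.val + 1) : w⁻¹ = w := by
  have hbc := h.val_c
  have hda := h'.val_c
  have fix : ∀ x, x ≠ a → x ≠ b → x ≠ c → x ≠ d → w x = x := by
    intro x ha hb hc hd
    have : x < a ∨ d < x := by
      clear h h' hda
      simp only [Fin.lt_def, ne_eq, Fin.ext_iff] at *
      omega
    rcases this with hx | hx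
    · have hxb := (hx.trans h.lt_ab).le
      refine le_antisymm ?_ (le_apply_of_increasing h.increasing_left x hxb)
      have h1 := h.increasing_left x a hx h.lt_ab.le
      have n1 := w.injective.ne hd
      simpa using le_apply_of_increasing h'.increasing_left (w x) (by
        simp only [Fin.lt_def, Fin.le_def, ne_eq, Fin.ext_iff] at *
        omega)
    · have hxc := (h.lt_cd.trans hx).le
      refine le_antisymm (apply_le_of_increasing h.increasing_right x hxc) ?_
      have h1 := h.increasing_right d x hx h.lt_cd.le
      have n1 := w.injective.ne ha
      simpa using apply_le_of_increasing h'.increasing_right (w x) (by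
        simp only [Fin.lt_def, Fin.le_def, ne_eq, Fin.ext_iff] at *
        omega)
  have mem : ∀ x, x = a ∨ x = b ∨ x = c ∨ x = d → w x = a ∨ w x = b ∨ w x = c ∨ w x = d := by
    intro x hx
    by_contra! hn
    have := w.injective (fix (w x) hn.1 hn.2.1 hn.2.2.1 hn.2.2.2)
    rw [this] at hn
    tauto
  have ma := mem a (by simp)
  have mb := mem b (by simp)
  have mc := mem c (by simp)
  have md := mem d (by simp)
  have l1 := h.apply_lt_cd
  have l2 := h.apply_lt_da
  have l3 := h.apply_lt_ab
  obtain ⟨wa, wb, wc, wd⟩ : w a = c ∧ w b = d ∧ w c = a ∧ w d = b := by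
    clear h h' fix mem
    simp only [Fin.lt_def, Fin.ext_iff] at *
    omega
  rw [inv_eq_iff_mul_eq_one]
  ext x : 1
  rw [Equiv.Perm.mul_apply, Equiv.Perm.one_apply]
  by_cases ha : x = a
  · rw [ha, wa, wc]
  by_cases hb : x = b
  · rw [hb, wb, wd]
  by_cases hc : x = c
  · rw [hc, wc, wa]
  by_cases hd : x = d
  · rw [hd, wd, wb]
  rw [fix x ha hb hc hd, fix x ha hb hc hd]

end IsCore3412

end Patterns

/-! ### The irreducible case and the induction. -/

section MainTheorem

variable {n : ℕ}

/-- Every descent of `w` is used by an occurrence of `321` or `3412`. -/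
def AllDescentsUsed (w : Equiv.Perm (Fin n)) : Prop :=
  ∀ p : Fin (n - 1), w (upperPt p) < w (lowerPt p) →
    ¬ (NotUsed pattern321 w p ∧ NotUsed pattern3412 w p)

lemma eq_of_patternCount_eq_one {k : ℕ} {q : Equiv.Perm (Fin k)} {w : Equiv.Perm (Fin n)}
    (h : patternCount q w = 1) {f f' : Fin k ↪o Fin n} (hf : IsPatternOccurrence q w f)
    (hf' : IsPatternOccurrence q w f') : f = f' := by
  have := (Nat.card_eq_one_iff_unique.1 h).1
  exact congrArg Subtype.val (Subsingleton.elim (⟨f, hf⟩ : {f // IsPatternOccurrence q w f}) ⟨f', hf'⟩)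

lemma exists_of_patternCount_eq_one {k : ℕ} {q : Equiv.Perm (Fin k)} {w : Equiv.Perm (Fin n)}
    (h : patternCount q w = 1) : ∃ f, IsPatternOccurrence q w f := by
  obtain ⟨⟨f, hf⟩⟩ := (Nat.card_eq_one_iff_unique.1 h).2
  exact ⟨f, hf⟩

lemma not_isPatternOccurrence {k : ℕ} {q : Equiv.Perm (Fin k)} {w : Equiv.Perm (Fin n)}
    (h : patternCount q w = 0) (f : Fin k ↪o Fin n) : ¬ IsPatternOccurrence q w f := fun hf => by
  have : Finite {f // IsPatternOccurrence q w f} :=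
    Finite.of_injective (fun f => (f.1 : Fin k → Fin n)) fun f f' e =>
      Subtype.ext (DFunLike.coe_injective e)
  exact (Finite.card_eq_zero_iff.1 h).false ⟨f, hf⟩

/-- With no `3412` and a single `321`, the occurrence using a given descent can only be this one. -/
lemma isCore321_of_patternCount {w : Equiv.Perm (Fin n)} (h3 : patternCount pattern321 w = 1)
    (h4 : patternCount pattern3412 w = 0) (hd : AllDescentsUsed w) {a b c : Fin n} (hab : a < b)
    (hbc : b < c) (h1 : w b < w a) (h2 : w c < w b) : IsCore321 w a b c := by
  refine ⟨hab, hbc, h1, h2, fun p hp => ?_⟩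
  obtain ⟨f, hf, f0, f1, f2⟩ := exists_isPatternOccurrence_321 hab hbc h1 h2
  have hu := hd p hp
  rw [not_and'] at hu
  have hu' := hu fun f' hf' => absurd hf' (not_isPatternOccurrence h4 f')
  unfold NotUsed at hu'
  push Not at hu'
  obtain ⟨f', hf', ⟨i, hi⟩, ⟨j, hj⟩⟩ := hu'
  rw [eq_of_patternCount_eq_one h3 hf' hf] at hi hj
  rw [← hi, ← hj, ← f0, ← f1, ← f2]
  constructor
  · fin_cases i <;> simp
  · fin_cases j <;> simp

lemma isCore3412_of_patternCount {w : Equiv.Perm (Fin n)} (h3 : patternCount pattern321 w = 0)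
    (h4 : patternCount pattern3412 w = 1) (hd : AllDescentsUsed w) {a b c d : Fin n} (hab : a < b)
    (hbc : b < c) (hcd : c < d) (h1 : w c < w d) (h2 : w d < w a) (h5 : w a < w b) :
    IsCore3412 w a b c d := by
  refine ⟨hab, hbc, hcd, h1, h2, h5, fun p hp => ?_⟩
  obtain ⟨f, hf, f0, f1, f2, f3⟩ := exists_isPatternOccurrence_3412 hab hbc hcd h1 h2 h5
  have hu := hd p hp
  rw [not_and] at hu
  have hu' := hu fun f' hf' => absurd hf' (not_isPatternOccurrence h3 f')
  unfold NotUsed at hu'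
  push Not at hu'
  obtain ⟨f', hf', ⟨i, hi⟩, ⟨j, hj⟩⟩ := hu'
  rw [eq_of_patternCount_eq_one h4 hf' hf] at hi hj
  rw [← hi, ← hj, ← f0, ← f1, ← f2, ← f3]
  constructor
  · fin_cases i <;> simp
  · fin_cases j <;> simp

lemma inv_eq_self_of_allDescentsUsed {w : Equiv.Perm (Fin n)} (hw : count321And3412 w = 1)
    (hd : AllDescentsUsed w) (hd' : AllDescentsUsed w⁻¹) : w⁻¹ = w := by
  have e3 := patternCount_inv pattern321 w
  have e4 := patternCount_inv pattern3412 w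
  rw [pattern321_inv] at e3
  rw [pattern3412_inv] at e4
  unfold count321And3412 at hw
  rcases Nat.add_eq_one_iff.1 hw with ⟨h3, h4⟩ | ⟨h3, h4⟩
  · obtain ⟨f, hf⟩ := exists_of_patternCount_eq_one h4
    have hc := isCore3412_of_patternCount h3 h4 hd (f.strictMono (show 0 < 1 by decide))
      (f.strictMono (show 1 < 2 by decide)) (f.strictMono (show 2 < 3 by decide))
      ((hf 2 3).2 (by decide)) ((hf 3 0).2 (by decide)) ((hf 0 1).2 (by decide))
    have hc' : IsCore3412 w⁻¹ (w (f 2)) (w (f 3)) (w (f 0)) (w (f 1)) :=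
      isCore3412_of_patternCount (e3.trans h3) (e4.trans h4) hd' hc.apply_lt_cd hc.apply_lt_da
        hc.apply_lt_ab (by simp) (by simp)
        (by simp)
    generalize f 0 = a, f 1 = b, f 2 = c, f 3 = d at hc hc'
    have huniq : ∀ {a' b' c' d'}, IsCore3412 w a b c d → a' < b' → b' < c' → c' < d' →
        w c' < w d' → w d' < w a' → w a' < w b' → b' = b ∧ c' = c := by
      intro a' b' c' d' hc g1 g2 g3 g4 g5 g6
      obtain ⟨f1, hf1, -, e1, e2, -⟩ := exists_isPatternOccurrence_3412 g1 g2 g3 g4 g5 g6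
      obtain ⟨f2, hf2, -, e3, e4, -⟩ := exists_isPatternOccurrence_3412 hc.lt_ab hc.lt_bc
        hc.lt_cd hc.apply_lt_cd hc.apply_lt_da hc.apply_lt_ab
      rw [← e1, ← e2, ← e3, ← e4, eq_of_patternCount_eq_one h4 hf1 hf2]
      exact ⟨rfl, rfl⟩
    refine hc.inv_eq hc' ?_ ?_
    · by_contra hne
      have hlt := hc.lt_ab
      rw [Fin.lt_def] at hlt
      -- If `a` and `b` were not adjacent, `w` would increase from `a` through `x` to `b`, and
      -- replacing `b` by `x` would give a second `3412`. The adjacency of `c` and `d` is obtained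
      -- in the same way by moving `c`.
      obtain ⟨x, hx⟩ : ∃ x : Fin n, x.val = a.val + 1 := ⟨⟨a.val + 1, by omega⟩, rfl⟩
      have hax : a < x := by rw [Fin.lt_def]; omega
      have hxb : x < b := by rw [Fin.lt_def]; omega
      have := huniq hc hax (hxb.trans hc.lt_bc) hc.lt_cd hc.apply_lt_cd hc.apply_lt_da
        (hc.increasing_left a x hax hxb.le)
      exact hxb.ne this.1
    · by_contra hne
      have hlt := hc.lt_cd
      rw [Fin.lt_def] at hlt
      obtain ⟨x, hx⟩ : ∃ x : Fin n, x.val = c.val + 1 := ⟨⟨c.val + 1, by omega⟩, rfl⟩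
      have hcx : c < x := by rw [Fin.lt_def]; omega
      have hxd : x < d := by rw [Fin.lt_def]; omega
      have := huniq hc hc.lt_ab (hc.lt_bc.trans hcx) hxd (hc.increasing_right x d hxd hcx.le)
        hc.apply_lt_da hc.apply_lt_ab
      exact hcx.ne' this.2
  · obtain ⟨f, hf⟩ := exists_of_patternCount_eq_one h3
    have hc := isCore321_of_patternCount h3 h4 hd (f.strictMono (show 0 < 1 by decide))
      (f.strictMono (show 1 < 2 by decide)) ((hf 1 0).2 (by decide)) ((hf 2 1).2 (by decide))
    exact hc.inv_eq <| isCore321_of_patternCount (e3.trans h3) (e4.trans h4) hd' hc.apply_lt_cb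
      hc.apply_lt_ba (by simp) (by simp)

/-- The lower Bruhat intervals of `w` and `w⁻¹` have parametrizations with the same family of
maximizer sets. -/
def HasEqualFamilies (w : Equiv.Perm (Fin n)) : Prop :=
  ∃ (ι : Type) (_ : Finite ι) (_ : Nonempty ι) (g g' : ι → Equiv.Perm (Fin n)),
    Set.range g = {u | BruhatLE u w} ∧ Set.range g' = {u | BruhatLE u w⁻¹} ∧
      maximizerFamily g = maximizerFamily g'

lemma HasEqualFamilies.inv {w : Equiv.Perm (Fin n)} (h : HasEqualFamilies w) :
    HasEqualFamilies w⁻¹ := by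
  obtain ⟨ι, hι, hι', g, g', h1, h2, h3⟩ := h
  exact ⟨ι, hι, hι', g', g, h2, by rwa [inv_inv], h3.symm⟩

lemma hasEqualFamilies_of_inv_eq {w : Equiv.Perm (Fin n)} (h : w⁻¹ = w) :
    HasEqualFamilies w :=
  ⟨{u // BruhatLE u w}, inferInstance, ⟨⟨1, one_bruhatLE w⟩⟩, Subtype.val, Subtype.val,
    Subtype.range_val, by rw [h]; exact Subtype.range_val, rfl⟩

lemma range_rightDouble {ι : Type*} {g : ι → Equiv.Perm (Fin n)} {w : Equiv.Perm (Fin n)}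
    (hg : Set.range g = {u | BruhatLE u w}) {p : Fin (n - 1)}
    (hw : w (lowerPt p) < w (upperPt p)) :
    Set.range (rightDouble g (simpleTransposition p)) =
      {u | BruhatLE u (w * simpleTransposition p)} := by
  have hmem : ∀ u, (∃ i, g i = u) ↔ BruhatLE u w := fun u => Set.ext_iff.1 hg u
  ext u
  change (∃ x, _ = u) ↔ BruhatLE u _
  rw [bruhatLE_mul_iff hw, ← hmem, ← hmem, Prod.exists, exists_comm, Bool.exists_bool]
  simp only [rightDouble, Bool.false_eq_true, if_false, if_true, ← eq_mul_inv_iff_mul_eq,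
    simpleTransposition_inv]

lemma range_leftDouble {ι : Type*} {g : ι → Equiv.Perm (Fin n)} {w : Equiv.Perm (Fin n)}
    (hg : Set.range g = {u | BruhatLE u w⁻¹}) {p : Fin (n - 1)}
    (hw : w (lowerPt p) < w (upperPt p)) :
    Set.range (leftDouble g (simpleTransposition p)) =
      {u | BruhatLE u (w * simpleTransposition p)⁻¹} := by
  have hmem : ∀ u, (∃ i, g i = u) ↔ BruhatLE u w⁻¹ := fun u => Set.ext_iff.1 hg u
  have hinv : ∀ u v : Equiv.Perm (Fin n), BruhatLE u v⁻¹ ↔ BruhatLE u⁻¹ v := fun u v =>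
    ⟨fun h => by simpa using h.inv, fun h => by simpa using h.inv⟩
  ext u
  change (∃ x, _ = u) ↔ BruhatLE u _
  have e : u⁻¹ * simpleTransposition p = (simpleTransposition p * u)⁻¹ := by simp
  rw [hinv, bruhatLE_mul_iff hw, e, ← hinv, ← hinv, ← hmem, ← hmem, Prod.exists, exists_comm,
    Bool.exists_bool]
  simp only [leftDouble, Bool.false_eq_true, if_false, if_true, ← eq_inv_mul_iff_mul_eq,
    simpleTransposition_inv]

/-- The interval of the product is a right doubling and that of its inverse is a left doubling, so
both families are prisms over the common family. -/
lemma HasEqualFamilies.mul_simpleTransposition {w : Equiv.Perm (Fin n)} {p : Fin (n - 1)}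
    (hw : SplitsAt p w) (h : HasEqualFamilies w) :
    HasEqualFamilies (w * simpleTransposition p) := by
  obtain ⟨ι, hι, hι', g, g', h1, h2, h3⟩ := h
  have hs : ∀ i, SplitsAt p (g i) := fun i =>
    hw.of_bruhatLE ((Set.ext_iff.1 h1 _).1 ⟨i, rfl⟩)
  have hs' : ∀ i, SplitsAt p (g' i) := fun i =>
    hw.inv.of_bruhatLE ((Set.ext_iff.1 h2 _).1 ⟨i, rfl⟩)
  refine ⟨ι × Bool, inferInstance, inferInstance, _, _, range_rightDouble h1 hw.ascent,
    range_leftDouble h2 hw.ascent, ?_⟩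
  rw [maximizerFamily_rightDouble hs, maximizerFamily_leftDouble h2 hs', h3]

lemma hasEqualFamilies_of_count (w : Equiv.Perm (Fin n)) (hw : count321And3412 w = 1) :
    HasEqualFamilies w := by
  induction hk : inversionCount w using Nat.strong_induction_on generalizing w with
  | _ k ih =>
    subst hk
    -- Stated for every `v` with as many inversions as `w`, so that it applies to both `w` and
    -- `w⁻¹`.
    have step : ∀ v : Equiv.Perm (Fin n), count321And3412 v = 1 →
        inversionCount v = inversionCount w → ¬ AllDescentsUsed v → HasEqualFamilies v := by
      intro v hv hvw hd
      unfold AllDescentsUsed at hd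
      push Not at hd
      obtain ⟨p, hp, h3, h4⟩ := hd
      have hcount := inversionCount_mul_of_descent v p hp
      have := ih _ (by omega) _ ((count321And3412_mul_of_notUsed hp h3 h4).trans hv) rfl
      simpa using this.mul_simpleTransposition (splitsAt_mul_of_notUsed hp h3 h4)
    by_cases hd : AllDescentsUsed w
    · by_cases hd' : AllDescentsUsed w⁻¹
      · exact hasEqualFamilies_of_inv_eq (inv_eq_self_of_allDescentsUsed hw hd hd')
      · simpa using
          (step w⁻¹ ((count321And3412_inv w).trans hw) (inversionCount_inv w) hd').inv
    · exact step w hw rfl hd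

end MainTheorem

theorem mainTheorem9 (n : ℕ) (w : Equiv.Perm (Fin n)) (hw : count321And3412 w = 1) :
    CombinatoriallyEquivalent (bruhatIntervalPolytope 1 w) (bruhatIntervalPolytope 1 w⁻¹) := by
  obtain ⟨ι, hι, hι', g, g', h1, h2, h3⟩ := hasEqualFamilies_of_count w hw
  exact combinatoriallyEquivalent_of_maximizerFamily_eq h1 h2 h3
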